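/- Let $N\ge 1$, $p>1$, and let $K\subset\mathbb R^N$ be a bounded convex symmetric set ($-K=K$) having the origin in its interior; let $\|x\|_K=\inf\{\lambda>0:\ x/\lambda\in K\}$ be the norm with unit ball $K$. For $z\in\mathbb C$ put $|z|_p=(|\Re z|^p+|\Im z|^p)^{1/p}$, and for $v\in\mathbb C^N$ put $$\|v\|_{Z_p^*K}=\Big(\frac{N+p}{p}\int_K |v\cdot x|_p^p\,dx\Big)^{1/p},\qquad v\cdot x=\sum_{j=1}^N v_jx_j .$$ Let $A:\mathbb R^N\to\mathbb R^N$ be Lipschitz, and let $W^{1,p}_{A,K}(\mathbb R^N)$ be the space of all $u\in L^p(\mathbb R^N,\mathbb C)$ that have a weak gradient $\nabla u\in L^1_{\rm loc}(\mathbb R^N,\mathbb C^N)$ with $\int_{\mathbb R^N}\|\nabla u-iA(x)u\|_{Z_p^*K}^p\,dx<\infty$. For $u:\mathbb R^N\to\mathbb C$ set $$\Psi_u(x,y)=e^{i(x-y)\cdot A\left(\frac{x+y}{2}\right)}u(y),\qquad x,y\in\mathbb R^N .$$ Then, for every $u\in W^{1,p}_{A,K}(\mathbb R^N)$, $$\lim_{\delta\searrow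 0}\int_{\mathbb R^N}\int_{\mathbb R^N}\frac{\delta^p}{\|x-y\|_K^{N+p}}\,\mathbf 1_{\{|\Psi_u(x,y)-\Psi_u(x,x)|_p>\delta\}}\,dx\,dy=\int_{\mathbb R^N}\|\nabla u-iA(x)u\|_{Z_p^*K}^p\,dx .$$ -/

import Mathlib

open MeasureTheory Filter Topology

noncomputable section

namespace AnisoMagnetic

/-- Euclidean space `ℝ^N`. -/
abbrev RN (N : ℕ) : Type := EuclideanSpace ℝ (Fin N)

/-- The space `ℂ^N`. -/
abbrev CN (N : ℕ) : Type := EuclideanSpace ℂ (Fin N)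

/-- `K` is the unit ball of a norm on `ℝ^N`: it is convex, symmetric, bounded, and the origin is an
interior point. The norm itself is `gauge K`, the Minkowski functional
`x ↦ inf {r > 0 | r⁻¹ • x ∈ K}`. Neither openness nor closedness of `K` is imposed. -/
structure IsNormUnitBall {N : ℕ} (K : Set (RN N)) : Prop where
  convex : Convex ℝ K
  symmetric : ∀ x ∈ K, -x ∈ K
  zero_mem_interior : (0 : RN N) ∈ interior K
  bounded : Bornology.IsBounded K

/-- `|z|_p = (|Re z|^p + |Im z|^p)^{1/p}` for a complex number `z`. -/
def absP (p : ℝ) (z : ℂ) : ℝ := (|z.re| ^ p + |z.im| ^ p) ^ (1 / p)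

/-- The bilinear product `v · x = ∑ j, v_j x_j` of `v ∈ ℂ^N` and `x ∈ ℝ^N`. -/
def cdot {N : ℕ} (v : CN N) (x : RN N) : ℂ := ∑ j, v j * (x j : ℂ)

/-- `‖v‖_{Z_p^*K} = ((N + p) / p * ∫_K |v · x|_p^p dx)^{1/p}`, the norm of the complex polar
`L_p`-moment body of `K`. -/
def momentNorm {N : ℕ} (p : ℝ) (K : Set (RN N)) (v : CN N) : ℝ :=
  (((N : ℝ) + p) / p * ∫ x in K, absP p (cdot v x) ^ p) ^ (1 / p)

/-- `G` is the weak (distributional) gradient of `u : ℝ^N → ℂ`. -/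
structure IsWeakGradient {N : ℕ} (u : RN N → ℂ) (G : RN N → CN N) : Prop where
  locallyIntegrable : LocallyIntegrable u volume
  locallyIntegrable_grad : LocallyIntegrable G volume
  integral_eq : ∀ φ : RN N → ℝ, ContDiff ℝ ((⊤ : ℕ∞) : WithTop ℕ∞) φ → HasCompactSupport φ →
    ∀ j : Fin N,
      ∫ x, ((fderiv ℝ φ x (EuclideanSpace.single j 1) : ℝ) : ℂ) * u x
        = -∫ x, ((φ x : ℝ) : ℂ) * G x j

/-- The magnetic gradient `∇u - i A u`, where `G` plays the role of `∇u`. -/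
def magGrad {N : ℕ} (A : RN N → RN N) (u : RN N → ℂ) (G : RN N → CN N) (x : RN N) : CN N :=
  WithLp.toLp 2 fun j => G x j - Complex.I * ((A x j : ℝ) : ℂ) * u x

/-- `∫ ‖∇u - i A u‖_{Z_p^*K}^p dx`, with values in `[0, ∞]`. -/
def magEnergy {N : ℕ} (p : ℝ) (K : Set (RN N)) (A : RN N → RN N) (u : RN N → ℂ)
    (G : RN N → CN N) : ENNReal :=
  ∫⁻ x, ENNReal.ofReal (momentNorm p K (magGrad A u G x) ^ p)

/-- Membership in the anisotropic magnetic Sobolev space `W^{1,p}_{A,K}(ℝ^N)`: `u ∈ L^p`, and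
`u` has a weak gradient for which `∫ ‖∇u - i A u‖_{Z_p^*K}^p dx` is finite. As `|·|_p` and the
modulus are equivalent norms on `ℂ`, they define the same space `L^p`. -/
structure MemMagSobolev {N : ℕ} (p : ℝ) (K : Set (RN N)) (A : RN N → RN N) (u : RN N → ℂ) :
    Prop where
  memLp : MemLp u (ENNReal.ofReal p) volume
  exists_grad : ∃ G : RN N → CN N, IsWeakGradient u G ∧ magEnergy p K A u G < ⊤

/-- `Ψ_u(x, y) = e^{i (x - y) · A((x + y) / 2)} u(y)`. -/
def Psi {N : ℕ} (A : RN N → RN N) (u : RN N → ℂ) (x y : RN N) : ℂ :=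
  Complex.exp (Complex.I * ((inner ℝ (x - y) (A ((1 / 2 : ℝ) • (x + y))) : ℝ) : ℂ)) * u y

/-- The nonlocal functional
`∬ δ^p / ‖x - y‖_K^{N+p} 1_{|Ψ_u(x,y) - Ψ_u(x,x)|_p > δ} dx dy`, with values in `[0, ∞]`.
For `δ > 0` the diagonal `x = y` is not in the set of integration. -/
def nonlocalFunctional {N : ℕ} (p : ℝ) (K : Set (RN N)) (A : RN N → RN N) (u : RN N → ℂ)
    (δ : ℝ) : ENNReal :=
  ∫⁻ z : RN N × RN N,
    Set.indicator {w : RN N × RN N | δ < absP p (Psi A u w.1 w.2 - Psi A u w.1 w.1)}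
      (fun w => ENNReal.ofReal (δ ^ p / gauge K (w.1 - w.2) ^ ((N : ℝ) + p))) z

end AnisoMagnetic

end

noncomputable section

namespace AnisoMagnetic

/-! Write V = ∇u - iAu and D_z(x) = Ψ_u(x, x+z) - Ψ_u(x, x). The substitution y = x + z turns the
functional into ∫ ‖z‖_K^{-(N+p)} δ^p |{|D_z|_p > δ}| dz (`IsNormUnitBall.nonlocalFunctional_eq`).
The region ‖z‖ > 1 disappears in the limit (`IsNormUnitBall.tendsto_far_part`). On ‖z‖ ≤ 1 the
scaling z = δw cancels all powers of δ (`near_part_eq`), and what remains is the integral of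
‖w‖_K^{-(N+p)} |{|D_{δw}|_p > δ}| over ‖δw‖ ≤ 1.

Pointwise limit in w: D_z is V·z up to an L^p error that is o(|z|)
(`IsWeakGradient.exists_modulus`), so D_{δw}/δ tends to V·w in measure, and the superlevel measures
tend to |{|V·w|_p > 1}| whenever the level 1 is not charged, which holds for almost every w
(`ae_measure_level_eq_zero`). Tonelli and a layer-cake computation in w
(`IsNormUnitBall.lintegral_kernel_cdot`) identify the integral of the limit with the energy.

Majorant: |D_z| is at most |z| times the average of F = |V| + L|u| over the segment from x to x+z. A
truncation followed by Markov's inequality bounds the superlevel measure by the integral of cF over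
{cF > 1}, with c = 4|w| (`measure_lt_mul_lintegral_segment_le`); no maximal function is needed.
Integrated against the kernel, this bound is a constant times ∫ F^p, and the constant is finite
because p > 1 (`IsNormUnitBall.lintegral_kernel_truncated_lt_top`).

Both estimates rest on a fundamental theorem of calculus for e^{-ist} u(x+tz). It is proved by
duality for a fixed phase s and then for all s off one null set
(`IsWeakGradient.ae_forall_phase_eq_integral`), so that s = z·A(x+z/2) may be inserted although it
depends on x. -/

theorem lintegral_eq_mul_lintegral_comp_smul {N : ℕ} (f : RN N → ENNReal) {r : ℝ} (hr : 0 < r) :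
    ∫⁻ z, f z = ENNReal.ofReal (r ^ N) * ∫⁻ w, f (r • w) := by
  have h1 : ∫⁻ w, f (r • w) = ∫⁻ z, f z ∂(Measure.map (r • ·) (volume : Measure (RN N))) :=
    ((Homeomorph.smulOfNeZero r hr.ne').measurableEmbedding.lintegral_map f).symm
  rw [h1, Measure.map_addHaar_smul volume hr.ne', lintegral_smul_measure, smul_eq_mul, ← mul_assoc,
    ← ENNReal.ofReal_mul (by positivity), finrank_euclideanSpace_fin, abs_of_pos (by positivity),
    mul_inv_cancel₀ (by positivity), ENNReal.ofReal_one, one_mul]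

/-! ### The norm |·|_p on ℂ. -/

section AbsP

variable {p : ℝ}

theorem absP_nonneg (p : ℝ) (z : ℂ) : 0 ≤ absP p z := by unfold absP; positivity

theorem absP_rpow (hp : 1 < p) (z : ℂ) : absP p z ^ p = |z.re| ^ p + |z.im| ^ p := by
  unfold absP
  rw [← Real.rpow_mul (by positivity), one_div, inv_mul_cancel₀ (by linarith), Real.rpow_one]

theorem absP_add_le (hp : 1 < p) (z w : ℂ) : absP p (z + w) ≤ absP p z + absP p w := by
  have h := Real.Lp_add_le (Finset.univ : Finset (Fin 2)) ![z.re, z.im] ![w.re, w.im] hp.le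
  simpa [absP, Fin.sum_univ_two] using h

theorem absP_le_two_mul_norm (hp : 1 < p) (z : ℂ) : absP p z ≤ 2 * ‖z‖ := by
  have h0 : (0 : ℝ) < p := by linarith
  have h := absP_add_le hp (z.re : ℂ) (z.im * Complex.I)
  rw [Complex.re_add_im] at h
  have h1 : absP p (z.re : ℂ) = |z.re| := by
    simp [absP, Real.zero_rpow h0.ne', ← Real.rpow_mul, mul_inv_cancel₀ h0.ne']
  have h2 : absP p (z.im * Complex.I) = |z.im| := by
    simp [absP, Real.zero_rpow h0.ne', ← Real.rpow_mul, mul_inv_cancel₀ h0.ne']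
  have := Complex.abs_re_le_norm z
  have := Complex.abs_im_le_norm z
  linarith

theorem absP_real_mul (hp : 1 < p) (r : ℝ) (z : ℂ) : absP p (r * z) = |r| * absP p z := by
  have h0 : (0 : ℝ) < p := by linarith
  unfold absP
  simp only [Complex.mul_re, Complex.ofReal_re, Complex.ofReal_im, zero_mul, sub_zero,
    Complex.mul_im, add_zero, abs_mul]
  rw [Real.mul_rpow (abs_nonneg _) (abs_nonneg _), Real.mul_rpow (abs_nonneg _) (abs_nonneg _),
    ← mul_add, Real.mul_rpow (by positivity) (by positivity),
    ← Real.rpow_mul (abs_nonneg _), mul_one_div_cancel h0.ne', Real.rpow_one]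

theorem continuous_absP (hp : 1 < p) : Continuous (absP p) := by
  have h0 : (0 : ℝ) < p := by linarith
  unfold absP
  refine Continuous.rpow_const (.add (.rpow_const (by fun_prop) ?_) (.rpow_const (by fun_prop) ?_)) ?_
  · exact fun _ => Or.inr h0.le
  · exact fun _ => Or.inr h0.le
  · exact fun _ => Or.inr (by positivity)

end AbsP

/-! ### The bilinear pairing of ℂ^N with ℝ^N. -/

section Cdot

variable {N : ℕ}

theorem cdot_smul (v : CN N) (r : ℝ) (x : RN N) : cdot v (r • x) = r * cdot v x := by
  simp only [cdot, PiLp.smul_apply, smul_eq_mul, Complex.ofReal_mul, Finset.mul_sum]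
  exact Finset.sum_congr rfl fun _ _ => by ring

theorem cdot_add (v : CN N) (x y : RN N) : cdot v (x + y) = cdot v x + cdot v y := by
  simp [cdot, mul_add, Finset.sum_add_distrib]

theorem cdot_sub_left (v w : CN N) (x : RN N) : cdot (v - w) x = cdot v x - cdot w x := by
  simp [cdot, sub_mul, Finset.sum_sub_distrib]

theorem norm_cdot_le (v : CN N) (x : RN N) : ‖cdot v x‖ ≤ ‖v‖ * ‖x‖ := by
  have h1 : ‖cdot v x‖ ≤ ∑ j, ‖v j‖ * ‖x j‖ := by
    refine (norm_sum_le _ _).trans (le_of_eq ?_)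
    exact Finset.sum_congr rfl fun _ _ => by simp
  rw [EuclideanSpace.norm_eq, EuclideanSpace.norm_eq]
  exact h1.trans (Real.sum_mul_le_sqrt_mul_sqrt _ _ _)

theorem continuous_cdot : Continuous fun q : CN N × RN N => cdot q.1 q.2 := by
  unfold cdot; fun_prop

theorem measurable_cdot : Measurable fun q : CN N × RN N => cdot q.1 q.2 := by
  unfold cdot; fun_prop

end Cdot

/-! ### The homogeneous kernel, its layer-cake formula and the moment norm. -/

section Kernel

variable {N : ℕ} {K : Set (RN N)} {p : ℝ}

/-- The kernel `‖z‖_K^{-(N+p)}`. -/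
def kernel (p : ℝ) (K : Set (RN N)) (z : RN N) : ENNReal :=
  ENNReal.ofReal ((gauge K z ^ ((N : ℝ) + p))⁻¹)

theorem IsNormUnitBall.mem_nhds (hK : IsNormUnitBall K) : K ∈ 𝓝 (0 : RN N) :=
  mem_interior_iff_mem_nhds.1 hK.zero_mem_interior

theorem IsNormUnitBall.continuous_gauge (hK : IsNormUnitBall K) : Continuous (gauge K) :=
  _root_.continuous_gauge hK.convex hK.mem_nhds

theorem IsNormUnitBall.measurable_kernel (hK : IsNormUnitBall K) : Measurable (kernel p K) := by
  have := hK.continuous_gauge.measurable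
  unfold kernel; fun_prop

theorem IsNormUnitBall.gauge_pos (hK : IsNormUnitBall K) {z : RN N} (hz : z ≠ 0) : 0 < gauge K z :=
  (_root_.gauge_pos (absorbent_nhds_zero hK.mem_nhds)
    ((NormedSpace.isVonNBounded_iff ℝ).2 hK.bounded)).2 hz

theorem IsNormUnitBall.exists_norm_le_mul_gauge (hK : IsNormUnitBall K) :
    ∃ R : ℝ, 0 < R ∧ ∀ z, ‖z‖ ≤ R * gauge K z := by
  obtain ⟨R, hR⟩ := hK.bounded.subset_closedBall 0
  refine ⟨max R 1, by positivity, fun z => ?_⟩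
  have := le_gauge_of_subset_closedBall (absorbent_nhds_zero hK.mem_nhds)
    (le_max_of_le_right zero_le_one)
    (hR.trans (Metric.closedBall_subset_closedBall (le_max_left R 1))) (x := z)
  rwa [div_le_iff₀' (by positivity)] at this

theorem kernel_smul {r : ℝ} (hr : 0 < r) (z : RN N) :
    kernel p K (r • z) = ENNReal.ofReal ((r ^ ((N : ℝ) + p))⁻¹) * kernel p K z := by
  unfold kernel
  rw [gauge_smul_of_nonneg hr.le, smul_eq_mul, Real.mul_rpow hr.le (gauge_nonneg z), mul_inv,
    ENNReal.ofReal_mul (by positivity)]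

theorem lintegral_Ioi_mul_rpow {q a : ℝ} (hq : 0 < q) (ha : 0 < a) (c : ℝ) (hc : 0 ≤ c) :
    ∫⁻ s in Set.Ioi a, ENNReal.ofReal (c * s ^ (-q - 1)) = ENNReal.ofReal (c / q * (a ^ q)⁻¹) := by
  rw [← ofReal_integral_eq_lintegral_ofReal]
  · rw [integral_const_mul, integral_Ioi_rpow_of_lt (by linarith) ha]
    congr 1
    rw [← Real.rpow_neg ha.le, show -q - 1 + 1 = -q by ring]
    field_simp
  · exact (integrableOn_Ioi_rpow_of_lt (by linarith) ha).const_mul c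
  · filter_upwards [ae_restrict_mem measurableSet_Ioi] with s hs
    have : 0 < s := ha.trans hs
    simp only [Pi.zero_apply]; positivity

theorem IsNormUnitBall.kernel_eq_lintegral (hK : IsNormUnitBall K) (hp : 1 < p) {z : RN N}
    (hz : z ≠ 0) :
    kernel p K z = ∫⁻ s in Set.Ioi (0 : ℝ), (Set.Ioi (gauge K z)).indicator
      (fun s => ENNReal.ofReal (((N : ℝ) + p) * s ^ (-((N : ℝ) + p) - 1))) s := by
  have hg := hK.gauge_pos hz
  have hq : (0 : ℝ) < N + p := by positivity
  rw [lintegral_indicator measurableSet_Ioi, Measure.restrict_restrict measurableSet_Ioi,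
    Set.inter_eq_left.2 (Set.Ioi_subset_Ioi hg.le), lintegral_Ioi_mul_rpow hq hg _ hq.le,
    div_self hq.ne', one_mul, kernel]

/-- Layer cake in the gauge: write the kernel as an integral over s > ‖w‖_K, exchange the integrals
and put w = sy. Homogeneity of φ turns the region into ‖y‖_K < 1, s > 1/φ(y), and the Jacobian s^N
turns the density into s^{-p-1}; the s-integral then gives φ(y)^p / p. -/
theorem IsNormUnitBall.lintegral_kernel_superlevel (hN : 1 ≤ N) (hK : IsNormUnitBall K) (hp : 1 < p)
    {φ : RN N → ℝ} (hφ : Measurable φ) (h0 : ∀ x, 0 ≤ φ x)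
    (hs : ∀ (r : ℝ) x, 0 < r → φ (r • x) = r * φ x) :
    ∫⁻ w, {w | 1 < φ w}.indicator (kernel p K) w
      = ∫⁻ y in {y | gauge K y < 1}, ENNReal.ofReal (((N : ℝ) + p) / p * φ y ^ p) := by
  have hq : (0 : ℝ) < N + p := by positivity
  have hg := hK.continuous_gauge.measurable
  have : Nonempty (Fin N) := ⟨⟨0, hN⟩⟩
  set c : ℝ → ENNReal := fun s => ENNReal.ofReal (((N : ℝ) + p) * s ^ (-((N : ℝ) + p) - 1)) with hc
  have hcm : Measurable c := by fun_prop
  -- At the origin the kernel has the default value 0 while the layer-cake integral diverges. Points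
  -- are null because N ≥ 1.
  have hz : ∀ᵐ w : RN N, w ≠ 0 := by simp [ae_iff, measure_singleton]
  have e1 : ∫⁻ w, {w | 1 < φ w}.indicator (kernel p K) w
      = ∫⁻ w, ∫⁻ s in Set.Ioi (0 : ℝ), {q : RN N × ℝ | 1 < φ q.1 ∧ gauge K q.1 < q.2}.indicator
          (fun q => c q.2) (w, s) := by
    refine lintegral_congr_ae ?_
    filter_upwards [hz] with w hw
    by_cases h : 1 < φ w
    · rw [Set.indicator_of_mem (by exact h), hK.kernel_eq_lintegral hp hw]
      simp [Set.indicator, h, hc]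
    · rw [Set.indicator_of_notMem (by exact h)]
      simp [Set.indicator, h]
  have hm : MeasurableSet {q : RN N × ℝ | 1 < φ q.1 ∧ gauge K q.1 < q.2} := by
    have h1 : MeasurableSet {q : RN N × ℝ | 1 < φ q.1} :=
      measurableSet_lt measurable_const (by fun_prop)
    have h2 : MeasurableSet {q : RN N × ℝ | gauge K q.1 < q.2} :=
      measurableSet_lt (by fun_prop) (by fun_prop)
    exact h1.inter h2
  rw [e1, lintegral_lintegral_swap (by
    exact ((hcm.comp measurable_snd).indicator hm).aemeasurable)]
  have e2 : ∀ s ∈ Set.Ioi (0 : ℝ), ∫⁻ w, {q : RN N × ℝ | 1 < φ q.1 ∧ gauge K q.1 < q.2}.indicator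
          (fun q => c q.2) (w, s)
      = ∫⁻ y, {q : RN N × ℝ | gauge K q.1 < 1 ∧ 1 < q.2 * φ q.1}.indicator
          (fun q => ENNReal.ofReal (((N : ℝ) + p) * q.2 ^ (-p - 1))) (y, s) := by
    intro s hs0
    have hs0 : 0 < s := hs0
    rw [lintegral_eq_mul_lintegral_comp_smul _ hs0, ← lintegral_const_mul' _ _ ENNReal.ofReal_ne_top]
    refine lintegral_congr fun y => ?_
    have : gauge K (s • y) < s ↔ gauge K y < 1 := by
      rw [gauge_smul_of_nonneg hs0.le, smul_eq_mul, mul_lt_iff_lt_one_right hs0]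
    simp only [Set.indicator, Set.mem_ofPred_eq, hs _ _ hs0, this, and_comm]
    split_ifs
    · rw [hc, ← ENNReal.ofReal_mul (by positivity)]
      congr 1
      rw [show -((N : ℝ) + p) - 1 = (-p - 1) - N by ring, Real.rpow_sub hs0, Real.rpow_natCast]
      field_simp
    · simp
  rw [setLIntegral_congr_fun measurableSet_Ioi e2]
  have hm2 : MeasurableSet {q : RN N × ℝ | gauge K q.1 < 1 ∧ 1 < q.2 * φ q.1} := by
    have h1 : MeasurableSet {q : RN N × ℝ | gauge K q.1 < 1} :=
      measurableSet_lt (by fun_prop) measurable_const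
    have h2 : MeasurableSet {q : RN N × ℝ | 1 < q.2 * φ q.1} :=
      measurableSet_lt measurable_const (by fun_prop)
    exact h1.inter h2
  rw [← lintegral_lintegral_swap (by
    refine (Measurable.indicator ?_ hm2).aemeasurable
    fun_prop), ← lintegral_indicator (measurableSet_lt hg measurable_const)]
  refine lintegral_congr fun y => ?_
  by_cases h : gauge K y < 1
  · rw [Set.indicator_of_mem (by exact h)]
    rcases (h0 y).eq_or_lt with h1 | h1
    · have : ¬ (1 : ℝ) < 0 := by norm_num
      simp [Set.indicator, ← h1, Real.zero_rpow (show p ≠ 0 by linarith), this]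
    · have : ∀ s, {q : RN N × ℝ | gauge K q.1 < 1 ∧ 1 < q.2 * φ q.1}.indicator
          (fun q => ENNReal.ofReal (((N : ℝ) + p) * q.2 ^ (-p - 1))) (y, s)
          = (Set.Ioi (φ y)⁻¹).indicator
          (fun s => ENNReal.ofReal (((N : ℝ) + p) * s ^ (-p - 1))) s := by
        intro s
        simp only [Set.indicator, Set.mem_ofPred_eq, h, true_and, Set.mem_Ioi, inv_lt_iff_one_lt_mul₀ h1]
      simp_rw [this]
      rw [lintegral_indicator measurableSet_Ioi, Measure.restrict_restrict measurableSet_Ioi,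
        Set.inter_eq_left.2 (Set.Ioi_subset_Ioi (by positivity)),
        lintegral_Ioi_mul_rpow (by linarith) (by positivity) _ hq.le, Real.inv_rpow h1.le, inv_inv]
  · rw [Set.indicator_of_notMem (by exact h)]
    simp [Set.indicator, h]

theorem absP_cdot_rpow_integrableOn (hK : IsNormUnitBall K) (hp : 1 < p) (v : CN N) :
    IntegrableOn (fun x => absP p (cdot v x) ^ p) K := by
  have hc : Continuous fun x => absP p (cdot v x) ^ p :=
    ((continuous_absP hp).comp (continuous_cdot.comp (by fun_prop : Continuous fun x => (v, x)))).rpow_const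
      fun _ => Or.inr (by linarith)
  obtain ⟨R, hR⟩ := hK.bounded.subset_closedBall 0
  exact (hc.continuousOn.integrableOn_compact (isCompact_closedBall 0 R)).mono_set hR

theorem momentNorm_rpow (hp : 1 < p) (v : CN N) :
    momentNorm p K v ^ p = ((N : ℝ) + p) / p * ∫ x in K, absP p (cdot v x) ^ p := by
  have h0 : (0 : ℝ) < p := by linarith
  unfold momentNorm
  rw [← Real.rpow_mul, one_div, inv_mul_cancel₀ h0.ne', Real.rpow_one]
  have : 0 ≤ ∫ x in K, absP p (cdot v x) ^ p :=
    integral_nonneg fun x => Real.rpow_nonneg (absP_nonneg _ _) _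
  positivity

theorem IsNormUnitBall.lintegral_kernel_cdot (hN : 1 ≤ N) (hK : IsNormUnitBall K) (hp : 1 < p)
    (v : CN N) :
    ∫⁻ w, {w | 1 < absP p (cdot v w)}.indicator (kernel p K) w
      = ENNReal.ofReal (momentNorm p K v ^ p) := by
  have h0 : (0 : ℝ) < p := by linarith
  rw [hK.lintegral_kernel_superlevel hN hp
    (φ := fun w => absP p (cdot v w))
    ((continuous_absP hp).comp (continuous_cdot.comp (by fun_prop : Continuous fun x => (v, x)))).measurable
    (fun _ => absP_nonneg _ _) (fun r x hr => by rw [cdot_smul, absP_real_mul hp, abs_of_pos hr]),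
    momentNorm_rpow hp, ← integral_const_mul, ofReal_integral_eq_lintegral_ofReal
      ((absP_cdot_rpow_integrableOn hK hp v).const_mul _)
      (ae_of_all _ fun x => by have := absP_nonneg p (cdot v x); simp only [Pi.zero_apply]; positivity),
    setOfPred_gauge_lt_one_eq_interior hK.convex hK.mem_nhds]
  -- The layer-cake formula sees the interior of K; a convex set has null frontier, so K itself may
  -- be used.
  exact setLIntegral_congr (interior_ae_eq_of_null_frontier (hK.convex.addHaar_frontier _))

theorem continuous_abs_inner_rpow (hp : 1 < p) (a : RN N) :
    Continuous fun x : RN N => |inner ℝ a x| ^ p :=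
  Continuous.rpow_const (by fun_prop) fun _ => Or.inr (by linarith)

theorem abs_inner_rpow_integrableOn (hK : IsNormUnitBall K) (hp : 1 < p) (a : RN N) :
    IntegrableOn (fun x => |inner ℝ a x| ^ p) K := by
  obtain ⟨R, hR⟩ := hK.bounded.subset_closedBall 0
  exact ((continuous_abs_inner_rpow hp a).continuousOn.integrableOn_compact
    (isCompact_closedBall 0 R)).mono_set hR

/-- If K contains the ball of radius r about 0, it contains the ball of radius r/4 about the point
of length r/2 in direction a, where ⟨a, x⟩ ≥ (r/4)‖a‖. -/
theorem IsNormUnitBall.exists_mul_norm_le_integral_inner (hK : IsNormUnitBall K) (hp : 1 < p) :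
    ∃ m : ℝ, 0 < m ∧ ∀ a : RN N, m * ‖a‖ ^ p ≤ ∫ x in K, |inner ℝ a x| ^ p := by
  have h0 : (0 : ℝ) < p := by linarith
  obtain ⟨r, hr, hrK⟩ := Metric.mem_nhds_iff.1 hK.mem_nhds
  refine ⟨(r / 4) ^ p * volume.real (Metric.ball (0 : RN N) (r / 4)), ?_, fun a => ?_⟩
  · have : 0 < volume.real (Metric.ball (0 : RN N) (r / 4)) :=
      ENNReal.toReal_pos (Metric.measure_ball_pos _ _ (by positivity)).ne' measure_ball_lt_top.ne
    positivity
  rcases eq_or_ne a 0 with rfl | ha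
  · simp [Real.zero_rpow h0.ne']
  have ha' : 0 < ‖a‖ := norm_pos_iff.2 ha
  set y : RN N := (r / (2 * ‖a‖)) • a with hy
  have hyn : ‖y‖ = r / 2 := by
    rw [hy, norm_smul, Real.norm_of_nonneg (by positivity)]; field_simp
  have hsub : Metric.ball y (r / 4) ⊆ K := by
    refine (fun x hx => hrK ?_)
    rw [mem_ball_zero_iff]
    have h1 := mem_ball_iff_norm.1 hx
    have h2 := norm_add_le y (x - y)
    rw [add_sub_cancel] at h2
    linarith
  have hin : ∀ x ∈ Metric.ball y (r / 4), (r / 4) ^ p * ‖a‖ ^ p ≤ |inner ℝ a x| ^ p := by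
    intro x hx
    rw [← Real.mul_rpow (by positivity) (by positivity)]
    refine Real.rpow_le_rpow (by positivity) (le_trans ?_ (le_abs_self _)) h0.le
    have h1 := mem_ball_iff_norm.1 hx
    have h2 : inner ℝ a x = inner ℝ a y + inner ℝ a (x - y) := by rw [← inner_add_right, add_sub_cancel]
    have h3 : inner ℝ a y = r / 2 * ‖a‖ := by
      rw [hy, inner_smul_right, real_inner_self_eq_norm_sq]; field_simp
    have h4 := abs_le.1 (abs_real_inner_le_norm a (x - y))
    have h5 : ‖a‖ * ‖x - y‖ ≤ ‖a‖ * (r / 4) := by gcongr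
    rw [h2, h3]
    linarith [h4.1]
  have hint := abs_inner_rpow_integrableOn hK hp a
  calc (r / 4) ^ p * volume.real (Metric.ball (0 : RN N) (r / 4)) * ‖a‖ ^ p
      = ∫ x in Metric.ball y (r / 4), (r / 4) ^ p * ‖a‖ ^ p := by
        rw [setIntegral_const, smul_eq_mul, Measure.addHaar_real_ball_center volume y]; ring
    _ ≤ ∫ x in Metric.ball y (r / 4), |inner ℝ a x| ^ p :=
        setIntegral_mono_on (integrableOn_const measure_ball_lt_top.ne) (hint.mono_set hsub)
          measurableSet_ball hin
    _ ≤ ∫ x in K, |inner ℝ a x| ^ p :=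
        setIntegral_mono_set hint (ae_of_all _ fun x => by simp only [Pi.zero_apply]; positivity)
          hsub.eventuallyLE

/-- The moment body norm dominates a multiple of the Euclidean norm. -/
theorem IsNormUnitBall.exists_norm_le_momentNorm (hK : IsNormUnitBall K) (hp : 1 < p) :
    ∃ c : ℝ, 0 ≤ c ∧ ∀ v : CN N, ‖v‖ ^ p ≤ c * momentNorm p K v ^ p := by
  have h0 : (0 : ℝ) < p := by linarith
  obtain ⟨m, hm, hmK⟩ := hK.exists_mul_norm_le_integral_inner hp
  refine ⟨2 ^ p / m * (p / (N + p)), by positivity, fun v => ?_⟩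
  -- With a and b the real and imaginary parts of v, |v·x|_p^p = |⟨a,x⟩|^p + |⟨b,x⟩|^p, so the real
  -- lower bound applies to each part.
  set a : RN N := WithLp.toLp 2 fun j => (v j).re with ha
  set b : RN N := WithLp.toLp 2 fun j => (v j).im with hb
  have hre : ∀ x, (cdot v x).re = inner ℝ a x := fun x => by
    simp [cdot, ha, PiLp.inner_apply, mul_comm]
  have him : ∀ x, (cdot v x).im = inner ℝ b x := fun x => by
    simp [cdot, hb, PiLp.inner_apply, mul_comm]
  have hv : ‖v‖ ≤ 2 * max ‖a‖ ‖b‖ := by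
    have h1 : ‖v‖ ^ 2 = ‖a‖ ^ 2 + ‖b‖ ^ 2 := by
      rw [EuclideanSpace.norm_sq_eq, EuclideanSpace.norm_sq_eq, EuclideanSpace.norm_sq_eq,
        ← Finset.sum_add_distrib]
      refine Finset.sum_congr rfl fun j _ => ?_
      simp only [ha, hb, Real.norm_eq_abs, sq_abs, Complex.sq_norm, Complex.normSq_apply]
      ring
    have h2 : ‖a‖ ≤ max ‖a‖ ‖b‖ := le_max_left _ _
    have h3 : ‖b‖ ≤ max ‖a‖ ‖b‖ := le_max_right _ _
    have h4 := norm_nonneg a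
    have h5 := norm_nonneg b
    refine le_of_sq_le_sq ?_ (by positivity)
    nlinarith
  have hv2 : ‖v‖ ^ p ≤ 2 ^ p * (‖a‖ ^ p + ‖b‖ ^ p) := by
    refine (Real.rpow_le_rpow (norm_nonneg _) hv h0.le).trans ?_
    rw [Real.mul_rpow (by norm_num) (by positivity)]
    have h4 : 0 ≤ ‖a‖ ^ p := by positivity
    have h5 : 0 ≤ ‖b‖ ^ p := by positivity
    gcongr
    rcases max_choice ‖a‖ ‖b‖ with h | h <;> rw [h] <;> linarith
  rw [momentNorm_rpow hp]
  have : ∫ x in K, absP p (cdot v x) ^ p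
      = (∫ x in K, |inner ℝ a x| ^ p) + ∫ x in K, |inner ℝ b x| ^ p := by
    rw [← integral_add (abs_inner_rpow_integrableOn hK hp a) (abs_inner_rpow_integrableOn hK hp b)]
    simp_rw [absP_rpow hp, hre, him]
  rw [this]
  have hq : (0 : ℝ) < N + p := by positivity
  calc ‖v‖ ^ p ≤ 2 ^ p * (‖a‖ ^ p + ‖b‖ ^ p) := hv2
    _ = 2 ^ p / m * (m * ‖a‖ ^ p + m * ‖b‖ ^ p) := by field_simp
    _ ≤ 2 ^ p / m * ((∫ x in K, |inner ℝ a x| ^ p) + ∫ x in K, |inner ℝ b x| ^ p) := by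
      gcongr <;> apply hmK
    _ = _ := by field_simp

end Kernel
-- The fundamental theorem of calculus along segments, with a phase.
section LineFormula

variable {N : ℕ}

/-- For t in (0, 1], translation by tz moves the ball of radius R into the ball of radius R + ‖z‖,
where g is integrable. This licenses the uses of Fubini below. -/
theorem integrable_comp_add_smul_prod {F : Type*} [NormedAddCommGroup F] {g : RN N → F}
    (hm : StronglyMeasurable g) (hg : LocallyIntegrable g) (z : RN N) (R : ℝ) :
    Integrable (fun q : RN N × ℝ => g (q.1 + q.2 • z))
      ((volume.restrict (Metric.closedBall 0 R)).prod (volume.restrict (Set.Ioc 0 1))) := by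
  have hmeas : StronglyMeasurable fun q : RN N × ℝ => g (q.1 + q.2 • z) :=
    hm.comp_measurable (by fun_prop)
  refine ⟨hmeas.aestronglyMeasurable, ?_⟩
  have hfin : ∫⁻ x in Metric.closedBall (0 : RN N) (R + ‖z‖), ‖g x‖ₑ < ⊤ :=
    (hg.integrableOn_isCompact (isCompact_closedBall _ _)).2
  rw [HasFiniteIntegral, lintegral_prod_symm _ hmeas.enorm.aemeasurable]
  calc ∫⁻ t in Set.Ioc (0 : ℝ) 1, ∫⁻ x in Metric.closedBall (0 : RN N) R, ‖g (x + t • z)‖ₑ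
      ≤ ∫⁻ t in Set.Ioc (0 : ℝ) 1, ∫⁻ x in Metric.closedBall (0 : RN N) (R + ‖z‖), ‖g x‖ₑ := by
        refine setLIntegral_mono' measurableSet_Ioc fun t ht => ?_
        rw [← lintegral_indicator measurableSet_closedBall,
          ← lintegral_indicator measurableSet_closedBall, ← lintegral_add_right_eq_self
            ((Metric.closedBall (0 : RN N) (R + ‖z‖)).indicator fun x => ‖g x‖ₑ) (t • z)]
        refine lintegral_mono fun x => ?_
        by_cases hx : x ∈ Metric.closedBall (0 : RN N) R
        · have : x + t • z ∈ Metric.closedBall (0 : RN N) (R + ‖z‖) := by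
            rw [mem_closedBall_zero_iff] at hx ⊢
            refine (norm_add_le _ _).trans (add_le_add hx ?_)
            rw [norm_smul, Real.norm_of_nonneg ht.1.le]
            exact mul_le_of_le_one_left (norm_nonneg _) ht.2
          rw [Set.indicator_of_mem hx, Set.indicator_of_mem this]
        · rw [Set.indicator_of_notMem hx]; simp
    _ < ⊤ := by simpa using hfin

theorem locallyIntegrable_of_closedBall {F : Type*} [NormedAddCommGroup F] {g : RN N → F}
    (h : ∀ R : ℝ, IntegrableOn g (Metric.closedBall 0 R)) : LocallyIntegrable g := by
  refine locallyIntegrable_iff.2 fun k hk => ?_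
  obtain ⟨R, hR⟩ := hk.isBounded.subset_closedBall 0
  exact (h R).mono_set hR

theorem ae_of_ae_closedBall {P : RN N → Prop}
    (h : ∀ R : ℝ, ∀ᵐ x ∂volume.restrict (Metric.closedBall (0 : RN N) R), P x) : ∀ᵐ x, P x := by
  have := ae_all_iff.2 fun n : ℕ => (ae_restrict_iff' measurableSet_closedBall).1 (h n)
  filter_upwards [this] with x hx
  obtain ⟨n, hn⟩ := exists_nat_ge ‖x‖
  exact hx n (mem_closedBall_zero_iff.2 hn)

theorem ae_integrable_comp_add_smul {F : Type*} [NormedAddCommGroup F] {g : RN N → F}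
    (hm : StronglyMeasurable g) (hg : LocallyIntegrable g) (z : RN N) :
    ∀ᵐ x, IntegrableOn (fun t : ℝ => g (x + t • z)) (Set.Ioc 0 1) :=
  ae_of_ae_closedBall fun R => (integrable_comp_add_smul_prod hm hg z R).prod_right_ae

theorem integrable_mul_comp_add_smul_prod {g : RN N → ℂ}
    (hm : StronglyMeasurable g) (hg : LocallyIntegrable g) (z : RN N) {ψ : RN N → ℂ}
    (hψ : Continuous ψ) (hψc : HasCompactSupport ψ) :
    Integrable (fun q : RN N × ℝ => ψ q.1 * g (q.1 + q.2 • z))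
      ((volume : Measure (RN N)).prod (volume.restrict (Set.Ioc 0 1))) := by
  obtain ⟨R, hR⟩ := hψc.isCompact.isBounded.subset_closedBall 0
  obtain ⟨C, hC⟩ := hψ.bounded_above_of_compact_support hψc
  have h2 : Integrable (fun q : RN N × ℝ => ψ q.1 * g (q.1 + q.2 • z))
      ((volume.restrict (Metric.closedBall 0 R)).prod (volume.restrict (Set.Ioc 0 1))) :=
    (integrable_comp_add_smul_prod hm hg z R).bdd_mul (c := C) (by fun_prop) (ae_of_all _ fun q => hC q.1)
  have h3 : (volume.restrict (Metric.closedBall 0 R)).prod (volume.restrict (Set.Ioc 0 1))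
      = ((volume : Measure (RN N)).prod ((volume : Measure ℝ).restrict (Set.Ioc 0 1))).restrict
        (Metric.closedBall 0 R ×ˢ Set.univ) := by
    rw [← Measure.prod_restrict, Measure.restrict_univ]
  rw [h3] at h2
  refine (integrableOn_iff_integrable_of_support_subset ?_).1 h2
  intro q hq
  refine ⟨hR (subset_closure ?_), trivial⟩
  exact fun h => hq (by simp only; rw [h, zero_mul])

theorem integrable_comp_sub_smul_mul_prod {g : RN N → ℂ} (hg : LocallyIntegrable g) (z : RN N) {ψ : RN N → ℂ}
    (hψ : Continuous ψ) (hψc : HasCompactSupport ψ) :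
    Integrable (fun q : RN N × ℝ => ψ (q.1 - q.2 • z) * g q.1)
      ((volume : Measure (RN N)).prod (volume.restrict (Set.Ioc 0 1))) := by
  obtain ⟨R, hR⟩ := hψc.isCompact.isBounded.subset_closedBall 0
  obtain ⟨C, hC⟩ := hψ.bounded_above_of_compact_support hψc
  have h1 : Integrable ((Metric.closedBall 0 (R + ‖z‖)).indicator g) :=
    (hg.integrableOn_isCompact (isCompact_closedBall _ _)).integrable_indicator
      measurableSet_closedBall
  have h2 : Integrable (fun q : RN N × ℝ => ψ (q.1 - q.2 • z) *
      (Metric.closedBall 0 (R + ‖z‖)).indicator g q.1)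
      ((volume : Measure (RN N)).prod (volume.restrict (Set.Ioc 0 1))) :=
    (h1.comp_fst (volume.restrict (Set.Ioc (0 : ℝ) 1))).bdd_mul (c := C)
      (by fun_prop) (ae_of_all _ fun q => hC _)
  refine h2.congr ?_
  have h3 : ∀ᵐ q ∂((volume : Measure (RN N)).prod (volume.restrict (Set.Ioc (0 : ℝ) 1))),
      q.2 ∈ Set.Ioc (0 : ℝ) 1 :=
    Measure.quasiMeasurePreserving_snd.ae (ae_restrict_mem measurableSet_Ioc)
  filter_upwards [h3] with q hq
  by_cases hx : q.1 ∈ Metric.closedBall (0 : RN N) (R + ‖z‖)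
  · rw [Set.indicator_of_mem hx]
  · rw [Set.indicator_of_notMem hx, mul_zero]
    suffices ψ (q.1 - q.2 • z) = 0 by rw [this, zero_mul]
    by_contra h
    apply hx
    have h4 := mem_closedBall_zero_iff.1 (hR (subset_closure h))
    rw [mem_closedBall_zero_iff]
    have h5 := norm_add_le (q.1 - q.2 • z) (q.2 • z)
    rw [sub_add_cancel, norm_smul, Real.norm_of_nonneg hq.1.le] at h5
    have h6 := mul_le_of_le_one_left (norm_nonneg z) hq.2
    linarith

variable {u : RN N → ℂ} {G : RN N → CN N}

theorem LocallyIntegrable.cdot (hG : LocallyIntegrable G) (z : RN N) :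
    LocallyIntegrable fun x => cdot (G x) z := by
  refine locallyIntegrable_of_closedBall fun R => ?_
  have h := hG.integrableOn_isCompact (isCompact_closedBall (0 : RN N) R)
  refine Integrable.mono' (h.norm.mul_const ‖z‖) ?_ (ae_of_all _ fun x => norm_cdot_le _ _)
  exact (continuous_cdot.comp (by fun_prop : Continuous fun v : CN N => (v, z))).comp_aestronglyMeasurable
    h.aestronglyMeasurable

theorem integrable_test_mul {g : RN N → ℂ} (hg : LocallyIntegrable g) {φ : RN N → ℝ}
    (hφ : Continuous φ) (hφc : HasCompactSupport φ) : Integrable fun x => (φ x : ℂ) * g x := by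
  simpa using hg.integrable_smul_left_of_hasCompactSupport hφ hφc

theorem IsWeakGradient.integral_fderiv_eq (h : IsWeakGradient u G) {φ : RN N → ℝ}
    (hφ : ContDiff ℝ ((⊤ : ℕ∞) : WithTop ℕ∞) φ) (hφc : HasCompactSupport φ) (z : RN N) :
    ∫ x, ((fderiv ℝ φ x z : ℝ) : ℂ) * u x = -∫ x, (φ x : ℂ) * cdot (G x) z := by
  have hz : z = ∑ j, z j • EuclideanSpace.single j (1 : ℝ) := by
    conv_lhs => rw [← (EuclideanSpace.basisFun (Fin N) ℝ).sum_repr z]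
    simp
  have e1 : ∀ x, ((fderiv ℝ φ x z : ℝ) : ℂ) * u x
      = ∑ j, (z j : ℂ) * (((fderiv ℝ φ x (EuclideanSpace.single j 1) : ℝ) : ℂ) * u x) := by
    intro x
    conv_lhs => rw [hz]
    simp only [map_sum, map_smul, smul_eq_mul, Complex.ofReal_sum, Complex.ofReal_mul,
      Finset.sum_mul, mul_assoc]
  have e2 : ∀ x, (φ x : ℂ) * cdot (G x) z = ∑ j, (z j : ℂ) * ((φ x : ℂ) * G x j) := by
    intro x
    simp only [cdot, Finset.mul_sum]
    exact Finset.sum_congr rfl fun _ _ => by ring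
  have hGj : ∀ j, LocallyIntegrable fun x => G x j := fun j => by
    have := LocallyIntegrable.cdot h.locallyIntegrable_grad (EuclideanSpace.single j (1 : ℝ))
    simpa [cdot, PiLp.single_apply, apply_ite Complex.ofReal] using this
  simp_rw [e1, e2]
  rw [integral_finsetSum, integral_finsetSum, ← Finset.sum_neg_distrib]
  · refine Finset.sum_congr rfl fun j _ => ?_
    rw [integral_const_mul, integral_const_mul, h.integral_eq φ hφ hφc j, mul_neg]
  · exact fun j _ => (integrable_test_mul (hGj j) hφ.continuous hφc).const_mul _
  · refine fun j _ => (integrable_test_mul h.locallyIntegrable (φ := fun x =>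
      fderiv ℝ φ x (EuclideanSpace.single j 1)) ?_ ?_).const_mul _
    · exact (hφ.continuous_fderiv (by simp)).clm_apply continuous_const
    · exact (hφc.fderiv (𝕜 := ℝ)).comp_left (g := fun L : RN N →L[ℝ] ℝ => L (EuclideanSpace.single j 1)) rfl

theorem LocallyIntegrable.comp_add_right {g : RN N → ℂ} (hg : LocallyIntegrable g) (z : RN N) :
    LocallyIntegrable fun x => g (x + z) := by
  refine locallyIntegrable_of_closedBall fun R => ?_
  have h1 : Integrable ((Metric.closedBall 0 (R + ‖z‖)).indicator g) :=
    (hg.integrableOn_isCompact (isCompact_closedBall _ _)).integrable_indicator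
      measurableSet_closedBall
  refine (h1.comp_add_right z).integrableOn.congr_fun (fun x hx => ?_) measurableSet_closedBall
  refine Set.indicator_of_mem ?_ _
  rw [mem_closedBall_zero_iff] at hx ⊢
  linarith [norm_add_le x z]

/-- Duality: after testing with φ, translations are moved from u to φ. There the classical
fundamental theorem for t ↦ e^{-ist} φ(x - tz) applies, and the weak gradient, tested with the
translate of φ, returns the derivative to u. The exceptional null set depends on s. -/
theorem IsWeakGradient.phase_eq_integral (h : IsWeakGradient u G) (hu : StronglyMeasurable u)
    (hG : StronglyMeasurable G) (z : RN N) (s : ℝ) :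
    ∀ᵐ x, Complex.exp (-(Complex.I * s)) * u (x + z) - u x
      = ∫ t in Set.Ioc (0 : ℝ) 1, Complex.exp (-(Complex.I * s * t)) *
          (cdot (G (x + t • z)) z - Complex.I * s * u (x + t • z)) := by
  set H : RN N → ℂ := fun y => cdot (G y) z - Complex.I * s * u y with hH
  set e : ℝ → ℂ := fun t => Complex.exp (-(Complex.I * s * t)) with he
  have hec : Continuous e := by fun_prop
  have hen : ∀ t, ‖e t‖ = 1 := fun t => by
    change ‖Complex.exp (-(Complex.I * s * t))‖ = 1
    rw [show -(Complex.I * s * t) = ((-(s * t) : ℝ) : ℂ) * Complex.I by push_cast; ring]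
    exact Complex.norm_exp_ofReal_mul_I _
  have hHm : StronglyMeasurable H :=
    ((continuous_cdot.comp (by fun_prop : Continuous fun v : CN N => (v, z))).comp_stronglyMeasurable
      hG).sub (hu.const_mul _)
  have hul := h.locallyIntegrable
  have hGl : LocallyIntegrable fun x => cdot (G x) z :=
    LocallyIntegrable.cdot h.locallyIntegrable_grad z
  have hHl : LocallyIntegrable H := hGl.sub (hul.smul (Complex.I * s))
  refine ae_eq_of_integral_contDiff_smul_eq
    (((LocallyIntegrable.comp_add_right hul z).smul (Complex.exp (-(Complex.I * s)))).sub hul)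
    (locallyIntegrable_of_closedBall fun R => Integrable.integral_prod_left
      (f := fun q : RN N × ℝ => e q.2 * H (q.1 + q.2 • z))
      ((integrable_comp_add_smul_prod hHm hHl z R).bdd_mul (c := 1) (by fun_prop)
        (ae_of_all _ fun q => (hen _).le))) fun φ hφ hφc => ?_
  have hφC := hφ.continuous
  have hdC : Continuous fun x => fderiv ℝ φ x z :=
    (hφ.continuous_fderiv (by simp)).clm_apply continuous_const
  have hdc : HasCompactSupport fun x => fderiv ℝ φ x z :=
    (hφc.fderiv (𝕜 := ℝ)).comp_left (g := fun L : RN N →L[ℝ] ℝ => L z) rfl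
  set ψ : RN N → ℂ := fun x => (φ x : ℂ) with hψ
  set dψ : RN N → ℂ := fun x => ((fderiv ℝ φ x z : ℝ) : ℂ) with hdψ
  have hψC : Continuous ψ := by fun_prop
  have hdψC : Continuous dψ := by fun_prop
  have hψc : HasCompactSupport ψ := hφc.comp_left (g := fun r : ℝ => (r : ℂ)) (by simp)
  have hdψc : HasCompactSupport dψ := hdc.comp_left (g := fun r : ℝ => (r : ℂ)) (by simp)
  -- This is the t-derivative of e t * ψ (x - t • z).
  set k : RN N → ℝ → ℂ := fun x t =>
    e t * (-(Complex.I * s) * ψ (x - t • z) - dψ (x - t • z)) with hk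
  have hftc : ∀ x, ∫ t in Set.Ioc (0 : ℝ) 1, k x t = e 1 * ψ (x - z) - ψ x := by
    intro x
    have hd : ∀ t : ℝ, HasDerivAt (fun t => e t * ψ (x - t • z)) (k x t) t := by
      intro t
      have h1 : HasDerivAt e (e t * -(Complex.I * s)) t := by
        have : HasDerivAt (fun t : ℝ => -(Complex.I * s * (t : ℂ))) (-(Complex.I * s)) t := by
          simpa using ((Complex.ofRealCLM.hasDerivAt (x := t)).const_mul (Complex.I * s)).fun_neg
        exact this.cexp
      have h2 : HasDerivAt (fun t : ℝ => φ (x - t • z)) (fderiv ℝ φ (x - t • z) (-z)) t := by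
        have h3 : HasDerivAt (fun t : ℝ => x - t • z) (-z) t := by
          simpa using ((hasDerivAt_id t).smul_const z).const_sub x
        exact ((hφ.differentiable (by simp)).differentiableAt.hasFDerivAt).comp_hasDerivAt t h3
      refine (h1.mul h2.ofReal_comp).congr_deriv ?_
      simp only [hk, hψ, hdψ, map_neg, Complex.ofReal_neg]
      ring
    have hkc : Continuous (k x) := by fun_prop
    rw [← intervalIntegral.integral_of_le zero_le_one,
      intervalIntegral.integral_eq_sub_of_hasDerivAt (fun t _ => hd t) (hkc.intervalIntegrable _ _)]
    simp [he]
  have hi1 : Integrable (fun q : RN N × ℝ => k q.1 q.2 * u q.1)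
      ((volume : Measure (RN N)).prod (volume.restrict (Set.Ioc 0 1))) := by
    have := (((integrable_comp_sub_smul_mul_prod hul z hψC hψc).const_mul (-(Complex.I * s))).sub
      (integrable_comp_sub_smul_mul_prod hul z hdψC hdψc)).bdd_mul (f := fun q => e q.2) (c := 1)
      (by fun_prop) (ae_of_all _ fun q => (hen _).le)
    refine this.congr (ae_of_all _ fun q => ?_)
    simp only [hk, Pi.sub_apply]; ring
  have hi2 : Integrable (fun q : RN N × ℝ => e q.2 * (ψ q.1 * H (q.1 + q.2 • z)))
      ((volume : Measure (RN N)).prod (volume.restrict (Set.Ioc 0 1))) :=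
    (integrable_mul_comp_add_smul_prod hHm hHl z hψC hψc).bdd_mul (c := 1)
      (by fun_prop) (ae_of_all _ fun q => (hen _).le)
  have hinner : ∀ t : ℝ, ∫ x, k x t * u x = ∫ x, e t * (ψ x * H (x + t • z)) := by
    intro t
    have hφt : ContDiff ℝ ((⊤ : ℕ∞) : WithTop ℕ∞) fun x => φ (x - t • z) :=
      hφ.comp (contDiff_id.sub contDiff_const)
    have hφtc : HasCompactSupport fun x => φ (x - t • z) :=
      hφc.comp_homeomorph (Homeomorph.subRight (t • z))
    have hw := h.integral_fderiv_eq hφt hφtc z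
    have hdt : ∀ x, fderiv ℝ (fun x => φ (x - t • z)) x z = fderiv ℝ φ (x - t • z) z := fun x => by
      rw [fderiv_comp_sub]
    simp_rw [hdt] at hw
    have j1 : Integrable fun x => ψ (x - t • z) * u x :=
      integrable_test_mul hul hφt.continuous hφtc
    have j2 : Integrable fun x => ψ (x - t • z) * cdot (G x) z :=
      integrable_test_mul hGl hφt.continuous hφtc
    have j3 : Integrable fun x => dψ (x - t • z) * u x :=
      integrable_test_mul hul (φ := fun x => fderiv ℝ φ (x - t • z) z)
        (hdC.comp (by fun_prop)) (hdc.comp_homeomorph (Homeomorph.subRight (t • z)))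
    have e1 : ∀ x, k x t * u x
        = e t * (-(Complex.I * s) * (ψ (x - t • z) * u x) - dψ (x - t • z) * u x) := fun x => by
      simp only [hk]; ring
    have e2 : ∀ x, ψ (x - t • z) * H x
        = -(Complex.I * s) * (ψ (x - t • z) * u x) + ψ (x - t • z) * cdot (G x) z := fun x => by
      simp only [hH]; ring
    rw [integral_const_mul, ← integral_sub_right_eq_self (fun x => ψ x * H (x + t • z)) (t • z)]
    simp only [sub_add_cancel]
    simp_rw [e1, e2]
    rw [integral_const_mul, integral_sub (j1.const_mul _) j3, integral_add (j1.const_mul _) j2, hw,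
      sub_neg_eq_add]
  have e0 : Complex.exp (-(Complex.I * s)) = e 1 := by simp [he]
  have hl : ∫ x, φ x • (Complex.exp (-(Complex.I * s)) * u (x + z) - u x)
      = ∫ x, (e 1 * ψ (x - z) - ψ x) * u x := by
    have j1 := integrable_test_mul hul hφC hφc
    have j2 := integrable_test_mul (LocallyIntegrable.comp_add_right hul z) hφC hφc
    have j3 := j2.comp_sub_right z
    simp only [sub_add_cancel] at j3
    have e1 : ∀ x, φ x • (Complex.exp (-(Complex.I * s)) * u (x + z) - u x)
        = e 1 * (ψ x * u (x + z)) - ψ x * u x := fun x => by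
      rw [e0, Complex.real_smul]; simp only [hψ]; ring
    have e2 : ∀ x, (e 1 * ψ (x - z) - ψ x) * u x = e 1 * (ψ (x - z) * u x) - ψ x * u x :=
      fun x => by ring
    simp_rw [e1, e2]
    rw [integral_sub (j2.const_mul _) j1, integral_sub (j3.const_mul _) j1, integral_const_mul,
      integral_const_mul, ← integral_sub_right_eq_self (fun x => ψ x * u (x + z)) z]
    simp only [sub_add_cancel]
    rfl
  calc ∫ x, φ x • (Complex.exp (-(Complex.I * s)) * u (x + z) - u x)
      = ∫ x, ∫ t in Set.Ioc (0 : ℝ) 1, k x t * u x := by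
        rw [hl]; simp_rw [integral_mul_const, hftc]
    _ = ∫ t in Set.Ioc (0 : ℝ) 1, ∫ x, k x t * u x :=
        integral_integral_swap (f := fun x t => k x t * u x) hi1
    _ = ∫ t in Set.Ioc (0 : ℝ) 1, ∫ x, e t * (ψ x * H (x + t • z)) := by simp_rw [hinner]
    _ = ∫ x, ∫ t in Set.Ioc (0 : ℝ) 1, e t * (ψ x * H (x + t • z)) :=
        (integral_integral_swap (f := fun x t => e t * (ψ x * H (x + t • z))) hi2).symm
    _ = _ := by
        refine integral_congr_ae (ae_of_all _ fun x => ?_)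
        simp only [Complex.real_smul]
        rw [← integral_const_mul]
        refine integral_congr_ae (ae_of_all _ fun t => ?_)
        simp only [hψ, hH, he]; ring

/-- The fundamental theorem of calculus along almost every segment of direction `z`, with
a phase that may depend on the base point. -/
theorem IsWeakGradient.ae_forall_phase_eq_integral (h : IsWeakGradient u G)
    (hu : StronglyMeasurable u) (hG : StronglyMeasurable G) (z : RN N) :
    ∀ᵐ x, ∀ s : ℝ, Complex.exp (-(Complex.I * s)) * u (x + z) - u x
      = ∫ t in Set.Ioc (0 : ℝ) 1, Complex.exp (-(Complex.I * s * t)) *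
          (cdot (G (x + t • z)) z - Complex.I * s * u (x + t • z)) := by
  have hGm : StronglyMeasurable fun x => cdot (G x) z :=
    (continuous_cdot.comp (by fun_prop : Continuous fun v : CN N => (v, z))).comp_stronglyMeasurable hG
  -- Only countably many null sets can be discarded together, so the formula is first taken for
  -- rational s. Both sides are continuous in s on almost every segment, and density gives all real
  -- s.
  filter_upwards [ae_all_iff.2 fun s : ℚ => h.phase_eq_integral hu hG z s,
    ae_integrable_comp_add_smul hu h.locallyIntegrable z,
    ae_integrable_comp_add_smul hGm (LocallyIntegrable.cdot h.locallyIntegrable_grad z) z]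
    with x hx hxu hxG
  have hcont : ∀ f : ℝ → ℂ, IntegrableOn f (Set.Ioc 0 1) →
      Continuous fun s : ℝ => ∫ t in Set.Ioc (0 : ℝ) 1, Complex.exp (-(Complex.I * s * t)) * f t := by
    intro f hf
    refine continuous_of_dominated (bound := fun t => ‖f t‖) (fun s => ?_) (fun s => ?_) hf.norm ?_
    · exact (Continuous.aestronglyMeasurable (by fun_prop)).mul hf.aestronglyMeasurable
    · refine ae_of_all _ fun t => ?_
      rw [norm_mul, show -(Complex.I * s * t) = ((-(s * t) : ℝ) : ℂ) * Complex.I by push_cast; ring,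
        Complex.norm_exp_ofReal_mul_I, one_mul]
    · exact ae_of_all _ fun t => by fun_prop
  have hsplit : ∀ s : ℝ, ∫ t in Set.Ioc (0 : ℝ) 1, Complex.exp (-(Complex.I * s * t)) *
      (cdot (G (x + t • z)) z - Complex.I * s * u (x + t • z))
      = (∫ t in Set.Ioc (0 : ℝ) 1, Complex.exp (-(Complex.I * s * t)) * cdot (G (x + t • z)) z)
        - Complex.I * s *
        ∫ t in Set.Ioc (0 : ℝ) 1, Complex.exp (-(Complex.I * s * t)) * u (x + t • z) := by
    intro s
    have hb : ∀ f : ℝ → ℂ, IntegrableOn f (Set.Ioc 0 1) →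
        IntegrableOn (fun t : ℝ => Complex.exp (-(Complex.I * s * t)) * f t) (Set.Ioc 0 1) := by
      refine fun f hf => hf.bdd_mul (c := 1) (Continuous.aestronglyMeasurable (by fun_prop))
        (ae_of_all _ fun t => ?_)
      rw [show -(Complex.I * s * t) = ((-(s * t) : ℝ) : ℂ) * Complex.I by push_cast; ring,
        Complex.norm_exp_ofReal_mul_I]
    rw [← integral_const_mul, ← integral_sub (hb _ hxG) ((hb _ hxu).const_mul _)]
    refine integral_congr_ae (ae_of_all _ fun t => ?_)
    simp only; ring
  have hc1 := hcont _ hxG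
  have hc2 := hcont _ hxu
  have hR : Continuous fun s : ℝ => ∫ t in Set.Ioc (0 : ℝ) 1, Complex.exp (-(Complex.I * s * t)) *
      (cdot (G (x + t • z)) z - Complex.I * s * u (x + t • z)) := by
    simp_rw [hsplit]; fun_prop
  refine fun s => congrFun (DenseRange.equalizer Rat.isDenseEmbedding_coe_real.dense
    (by fun_prop : Continuous fun s : ℝ => Complex.exp (-(Complex.I * s)) * u (x + z) - u x)
    hR (funext fun r => ?_)) s
  simpa using hx r

end LineFormula
-- The magnetic difference and its first-order expansion.
section MagneticDifference

variable {N : ℕ} {A : RN N → RN N} {u : RN N → ℂ} {G : RN N → CN N} {p : ℝ}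

/-- The difference `Ψ_u(x, x + z) - Ψ_u(x, x)`. -/
def psiDiff (A : RN N → RN N) (u : RN N → ℂ) (z x : RN N) : ℂ :=
  Psi A u x (x + z) - Psi A u x x

theorem Psi_self (A : RN N → RN N) (u : RN N → ℂ) (x : RN N) : Psi A u x x = u x := by
  simp [Psi]

theorem Psi_add (A : RN N → RN N) (u : RN N → ℂ) (x z : RN N) :
    Psi A u x (x + z) = Complex.exp (-(Complex.I *
      ((inner ℝ z (A (x + (1 / 2 : ℝ) • z)) : ℝ) : ℂ))) * u (x + z) := by
  have h1 : x - (x + z) = -z := by abel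
  have h2 : (1 / 2 : ℝ) • (x + (x + z)) = x + (1 / 2 : ℝ) • z := by module
  rw [Psi, h1, h2, inner_neg_left, Complex.ofReal_neg, mul_neg]

theorem norm_psiDiff_le (A : RN N → RN N) (u : RN N → ℂ) (z x : RN N) :
    ‖psiDiff A u z x‖ ≤ ‖u (x + z)‖ + ‖u x‖ := by
  refine (norm_sub_le _ _).trans (le_of_eq ?_)
  rw [Psi_self, Psi_add, norm_mul, ← mul_neg, ← Complex.ofReal_neg, Complex.norm_exp_I_mul_ofReal,
    one_mul]

theorem cdot_magGrad (A : RN N → RN N) (u : RN N → ℂ) (G : RN N → CN N) (x z : RN N) :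
    cdot (magGrad A u G x) z
      = cdot (G x) z - Complex.I * ((inner ℝ z (A x) : ℝ) : ℂ) * u x := by
  simp only [cdot, magGrad, PiLp.inner_apply, RCLike.inner_apply, conj_trivial, Complex.ofReal_sum,
    Complex.ofReal_mul, Finset.mul_sum, Finset.sum_mul, ← Finset.sum_sub_distrib]
  exact Finset.sum_congr rfl fun _ _ => by ring

theorem stronglyMeasurable_magGrad (hA : Continuous A) (hu : StronglyMeasurable u)
    (hG : StronglyMeasurable G) : StronglyMeasurable (magGrad A u G) := by
  have h1 : Measurable fun x => fun j => G x j - Complex.I * ((A x j : ℝ) : ℂ) * u x := by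
    have := hG.measurable
    have := hu.measurable
    have := hA.measurable
    refine measurable_pi_lambda _ fun j => ?_
    fun_prop
  exact ((PiLp.continuous_toLp 2 _).measurable.comp h1).stronglyMeasurable

/-- The line formula with the phase frozen at s = z·A(x + z/2), a choice depending on x. Replacing
the midpoint value of A by its value at x + tz produces the magnetic gradient and leaves a Lipschitz
correction. -/
theorem IsWeakGradient.psiDiff_eq_integral (h : IsWeakGradient u G) (hu : StronglyMeasurable u)
    (hG : StronglyMeasurable G) (A : RN N → RN N) (z : RN N) :
    ∀ᵐ x, psiDiff A u z x = ∫ t in Set.Ioc (0 : ℝ) 1,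
      Complex.exp (-(Complex.I * ((inner ℝ z (A (x + (1 / 2 : ℝ) • z)) : ℝ) : ℂ) * t)) *
        (cdot (magGrad A u G (x + t • z)) z + Complex.I *
          ((inner ℝ z (A (x + t • z) - A (x + (1 / 2 : ℝ) • z)) : ℝ) : ℂ) * u (x + t • z)) := by
  filter_upwards [h.ae_forall_phase_eq_integral hu hG z] with x hx
  rw [psiDiff, Psi_self, Psi_add, hx]
  refine integral_congr_ae (ae_of_all _ fun t => ?_)
  simp only [cdot_magGrad, inner_sub_right, Complex.ofReal_sub]
  ring

theorem norm_inner_sub_le {L : NNReal} (hA : LipschitzWith L A) (x z : RN N) {t : ℝ}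
    (ht : t ∈ Set.Ioc (0 : ℝ) 1) :
    |inner ℝ z (A (x + t • z) - A (x + (1 / 2 : ℝ) • z))| ≤ ‖z‖ * (L * ‖z‖) := by
  refine (abs_real_inner_le_norm _ _).trans ?_
  gcongr
  have h1 := hA.norm_sub_le (x + t • z) (x + (1 / 2 : ℝ) • z)
  refine h1.trans ?_
  gcongr
  rw [show x + t • z - (x + (1 / 2 : ℝ) • z) = (t - 1 / 2) • z by module, norm_smul]
  refine mul_le_of_le_one_left (norm_nonneg _) ?_
  rw [Real.norm_eq_abs, abs_le]
  constructor <;> linarith [ht.1, ht.2]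

theorem enorm_I_mul_inner_le {L : NNReal} (hA : LipschitzWith L A) (x z : RN N) {t : ℝ}
    (ht : t ∈ Set.Ioc (0 : ℝ) 1) :
    ‖Complex.I‖ₑ * ‖((inner ℝ z (A (x + t • z) - A (x + (1 / 2 : ℝ) • z)) : ℝ) : ℂ)‖ₑ
      ≤ ‖z‖ₑ * L * ‖z‖ₑ := by
  rw [← ofReal_norm, Complex.norm_I, ENNReal.ofReal_one, one_mul, ← ofReal_norm, ← ofReal_norm,
    Complex.norm_real, ← ENNReal.ofReal_coe_nnreal, ← ENNReal.ofReal_mul (norm_nonneg _),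
    ← ENNReal.ofReal_mul (by positivity), mul_assoc]
  exact ENNReal.ofReal_le_ofReal (norm_inner_sub_le hA x z ht)

theorem enorm_cdot_le (v : CN N) (z : RN N) : ‖cdot v z‖ₑ ≤ ‖z‖ₑ * ‖v‖ₑ := by
  rw [mul_comm, ← ofReal_norm, ← ofReal_norm, ← ofReal_norm, ← ENNReal.ofReal_mul (norm_nonneg _)]
  exact ENNReal.ofReal_le_ofReal (norm_cdot_le _ _)

theorem norm_exp_neg_I_mul_mul (s t : ℝ) : ‖Complex.exp (-(Complex.I * s * t))‖ = 1 := by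
  rw [show -(Complex.I * s * t) = ((-(s * t) : ℝ) : ℂ) * Complex.I by push_cast; ring,
    Complex.norm_exp_ofReal_mul_I]

theorem norm_exp_neg_I_mul_mul_sub_one_le (s : ℝ) {t : ℝ} (ht : t ∈ Set.Ioc (0 : ℝ) 1) :
    ‖Complex.exp (-(Complex.I * s * t)) - 1‖ ≤ min 2 |s| := by
  refine le_min ?_ ?_
  · refine (norm_sub_le _ _).trans ?_
    rw [norm_exp_neg_I_mul_mul]; norm_num
  · rw [show -(Complex.I * s * t) = Complex.I * ((-(s * t) : ℝ) : ℂ) by push_cast; ring]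
    refine (Real.norm_exp_I_mul_ofReal_sub_one_le).trans ?_
    rw [Real.norm_eq_abs, abs_neg, abs_mul, abs_of_pos ht.1]
    exact mul_le_of_le_one_right (abs_nonneg _) ht.2

theorem IsWeakGradient.enorm_psiDiff_le (h : IsWeakGradient u G) (hu : StronglyMeasurable u)
    (hG : StronglyMeasurable G) {L : NNReal} (hA : LipschitzWith L A) (z : RN N) :
    ∀ᵐ x, ‖psiDiff A u z x‖ₑ ≤ ‖z‖ₑ * ∫⁻ t in Set.Ioc (0 : ℝ) 1,
      (‖magGrad A u G (x + t • z)‖ₑ + L * ‖z‖ₑ * ‖u (x + t • z)‖ₑ) := by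
  filter_upwards [h.psiDiff_eq_integral hu hG A z] with x hx
  rw [hx, ← lintegral_const_mul' _ _ enorm_ne_top]
  refine (enorm_integral_le_lintegral_enorm _).trans (setLIntegral_mono' measurableSet_Ioc fun t ht => ?_)
  rw [enorm_mul, ← ofReal_norm, norm_exp_neg_I_mul_mul, ENNReal.ofReal_one, one_mul]
  refine (enorm_add_le _ _).trans ?_
  rw [mul_add]
  refine add_le_add ?_ ?_
  · exact enorm_cdot_le _ _
  · rw [enorm_mul, enorm_mul, ← mul_assoc, ← mul_assoc]
    exact mul_le_mul_left (enorm_I_mul_inner_le hA x z ht) _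

/-- The three terms are the oscillation of V along the segment, the deviation of the phase from 1,
and the Lipschitz correction. Since A may be unbounded, the phase deviation is not small uniformly
in x; the cap 2 allows dominated convergence. -/
theorem IsWeakGradient.enorm_psiDiff_sub_le (h : IsWeakGradient u G) (hu : StronglyMeasurable u)
    (hG : StronglyMeasurable G) {L : NNReal} (hA : LipschitzWith L A) (z : RN N) :
    ∀ᵐ x, ‖psiDiff A u z x - cdot (magGrad A u G x) z‖ₑ ≤ ‖z‖ₑ * ∫⁻ t in Set.Ioc (0 : ℝ) 1,
      (‖magGrad A u G (x + t • z) - magGrad A u G x‖ₑ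
        + (ENNReal.ofReal (min 2 |inner ℝ z (A (x + (1 / 2 : ℝ) • z))|) * ‖magGrad A u G x‖ₑ
        + L * ‖z‖ₑ * ‖u (x + t • z)‖ₑ)) := by
  have hGm : StronglyMeasurable fun x => cdot (G x) z :=
    (continuous_cdot.comp (by fun_prop : Continuous fun v : CN N => (v, z))).comp_stronglyMeasurable hG
  filter_upwards [h.psiDiff_eq_integral hu hG A z,
    ae_integrable_comp_add_smul hu h.locallyIntegrable z,
    ae_integrable_comp_add_smul hGm (LocallyIntegrable.cdot h.locallyIntegrable_grad z) z]
    with x hx hxu hxG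
  set s : ℝ := inner ℝ z (A (x + (1 / 2 : ℝ) • z)) with hs
  set V := magGrad A u G with hV
  set f : ℝ → ℂ := fun t => Complex.exp (-(Complex.I * s * t)) * (cdot (V (x + t • z)) z + Complex.I *
          ((inner ℝ z (A (x + t • z) - A (x + (1 / 2 : ℝ) • z)) : ℝ) : ℂ) * u (x + t • z)) with hf
  have hfi : IntegrableOn f (Set.Ioc 0 1) := by
    -- In the integrand the values A (x + t • z) cancel, so integrability of G·z and of u along the
    -- segment suffices.
    have h1 : IntegrableOn (fun t : ℝ => cdot (G (x + t • z)) z - Complex.I * s * u (x + t • z))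
        (Set.Ioc 0 1) := hxG.sub (hxu.const_mul _)
    refine (h1.bdd_mul (f := fun t : ℝ => Complex.exp (-(Complex.I * s * t))) (c := 1)
      (Continuous.aestronglyMeasurable (by fun_prop))
      (ae_of_all _ fun t => (norm_exp_neg_I_mul_mul s t).le)).congr (ae_of_all _ fun t => ?_)
    simp only [hf, hV, cdot_magGrad, inner_sub_right, Complex.ofReal_sub, hs]
    ring
  have hc : cdot (V x) z = ∫ t in Set.Ioc (0 : ℝ) 1, cdot (V x) z := by simp
  rw [hx, hc, ← integral_sub hfi (by simp), ← lintegral_const_mul' _ _ enorm_ne_top]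
  refine (enorm_integral_le_lintegral_enorm _).trans (setLIntegral_mono' measurableSet_Ioc fun t ht => ?_)
  have hsplit : f t - cdot (V x) z = Complex.exp (-(Complex.I * s * t)) * cdot (V (x + t • z) - V x) z
      + ((Complex.exp (-(Complex.I * s * t)) - 1) * cdot (V x) z
      + Complex.exp (-(Complex.I * s * t)) * (Complex.I *
          ((inner ℝ z (A (x + t • z) - A (x + (1 / 2 : ℝ) • z)) : ℝ) : ℂ) * u (x + t • z))) := by
    rw [cdot_sub_left, hf]; ring
  have h1 := norm_exp_neg_I_mul_mul s t
  rw [hsplit]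
  refine (enorm_add_le _ _).trans ?_
  rw [mul_add, mul_add]
  refine add_le_add ?_ ((enorm_add_le _ _).trans (add_le_add ?_ ?_))
  · rw [enorm_mul, ← ofReal_norm (Complex.exp _), h1, ENNReal.ofReal_one, one_mul]
    exact enorm_cdot_le _ _
  · rw [enorm_mul, mul_left_comm]
    gcongr
    · rw [← ofReal_norm]
      exact ENNReal.ofReal_le_ofReal (norm_exp_neg_I_mul_mul_sub_one_le s ht)
    · exact enorm_cdot_le _ _
  · rw [enorm_mul, ← ofReal_norm (Complex.exp _), h1, ENNReal.ofReal_one, one_mul, enorm_mul,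
      enorm_mul, ← mul_assoc, ← mul_assoc]
    exact mul_le_mul_left (enorm_I_mul_inner_le hA x z ht) _

end MagneticDifference

/-! ### The integrable majorant for the rescaled functional. -/

section Domination

variable {N : ℕ} {K : Set (RN N)} {p : ℝ}

theorem lintegral_comp_add_smul {F : RN N → ENNReal} (hF : Measurable F) (z : RN N) :
    ∫⁻ x, ∫⁻ t in Set.Ioc (0 : ℝ) 1, F (x + t • z) = ∫⁻ x, F x := by
  rw [lintegral_lintegral_swap (by fun_prop)]
  simp_rw [lintegral_add_right_eq_self F]
  simp

/-- Weak-type estimate for averages over segments, with truncated right-hand side. -/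
theorem measure_lt_mul_lintegral_segment_le {F : RN N → ENNReal} (hF : Measurable F) (z : RN N)
    (c : ENNReal) :
    volume {x | 2 < c * ∫⁻ t in Set.Ioc (0 : ℝ) 1, F (x + t • z)}
      ≤ ∫⁻ x, {x | 1 < c * F x}.indicator (fun x => c * F x) x := by
  have hcF : Measurable fun x => c * F x := hF.const_mul c
  set F₁ : RN N → ENNReal := {x | 1 < c * F x}.indicator (fun x => c * F x) with hF₁
  have hm : Measurable F₁ := hcF.indicator (measurableSet_lt measurable_const hcF)
  -- Values of cF up to 1 contribute at most 1 to an average, so an average above 2 forces the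
  -- average of F₁ above 1. Markov's inequality then applies to F₁.
  have hle : ∀ x, c * F x ≤ 1 + F₁ x := fun x => by
    by_cases hx : 1 < c * F x
    · rw [hF₁, Set.indicator_of_mem (by exact hx)]; exact le_add_self
    · exact (not_lt.1 hx).trans le_self_add
  have hmi : Measurable fun x => ∫⁻ t in Set.Ioc (0 : ℝ) 1, F₁ (x + t • z) :=
    Measurable.lintegral_prod_right' (f := fun q : RN N × ℝ => F₁ (q.1 + q.2 • z))
      (by fun_prop)
  calc volume {x | 2 < c * ∫⁻ t in Set.Ioc (0 : ℝ) 1, F (x + t • z)}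
      ≤ volume {x | 1 ≤ ∫⁻ t in Set.Ioc (0 : ℝ) 1, F₁ (x + t • z)} := by
        refine measure_mono fun x hx => ?_
        have h1 : c * ∫⁻ t in Set.Ioc (0 : ℝ) 1, F (x + t • z)
            ≤ 1 + ∫⁻ t in Set.Ioc (0 : ℝ) 1, F₁ (x + t • z) := by
          rw [← lintegral_const_mul _ (by fun_prop)]
          refine (lintegral_mono fun t => hle _).trans ?_
          rw [lintegral_add_left measurable_const]
          simp
        have h2 : (1 : ENNReal) + 1 < 1 + ∫⁻ t in Set.Ioc (0 : ℝ) 1, F₁ (x + t • z) := by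
          rw [one_add_one_eq_two]; exact lt_of_lt_of_le hx h1
        exact (lt_of_add_lt_add_left h2).le
    _ ≤ ∫⁻ x, ∫⁻ t in Set.Ioc (0 : ℝ) 1, F₁ (x + t • z) := by
        simpa using mul_meas_ge_le_lintegral (μ := (volume : Measure (RN N))) hmi 1
    _ = ∫⁻ x, F₁ x := lintegral_comp_add_smul hm z

/-- The integrand lives on ‖w‖ > 1/4, away from the singularity, and decays like ‖w‖^{1-N-p}; this
is integrable at infinity because p > 1. -/
theorem IsNormUnitBall.lintegral_kernel_mul_norm_lt_top (hK : IsNormUnitBall K) (hp : 1 < p) :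
    ∫⁻ w : RN N, kernel p K w * {w : RN N | 1 < 4 * ‖w‖ₑ}.indicator (fun w => 4 * ‖w‖ₑ) w < ⊤ := by
  obtain ⟨R, hR, hRK⟩ := hK.exists_norm_le_mul_gauge
  set q : ℝ := (N : ℝ) + p with hq
  have hq0 : 0 < q := by positivity
  have hi := (integrable_one_add_norm (E := RN N) (μ := volume) (r := q - 1)
    (by rw [finrank_euclideanSpace_fin]; linarith)).const_mul (4 * R ^ q * 5 ^ (q - 1))
  refine lt_of_le_of_lt (lintegral_mono fun w => ?_) hi.lintegral_lt_top
  by_cases hw : (1 : ENNReal) < 4 * ‖w‖ₑ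
  · rw [Set.indicator_of_mem (by exact hw)]
    have hw' : 1 < 4 * ‖w‖ := by
      rw [← ofReal_norm, ← ENNReal.ofReal_ofNat 4, ← ENNReal.ofReal_mul (by norm_num),
        ENNReal.one_lt_ofReal] at hw
      exact hw
    have hw0 : 0 < ‖w‖ := by linarith
    have hg : 0 < gauge K w := hK.gauge_pos (norm_pos_iff.1 hw0)
    rw [kernel, ← ofReal_norm w, ← ENNReal.ofReal_ofNat 4, ← ENNReal.ofReal_mul (by norm_num),
      ← ENNReal.ofReal_mul (by positivity)]
    refine ENNReal.ofReal_le_ofReal ?_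
    have h1 : (gauge K w ^ q)⁻¹ ≤ R ^ q * (‖w‖ ^ q)⁻¹ := by
      rw [← div_eq_mul_inv, le_div_iff₀ (by positivity), inv_mul_le_iff₀ (by positivity), mul_comm,
        ← Real.mul_rpow (by positivity) (by positivity)]
      exact Real.rpow_le_rpow hw0.le (hRK w) hq0.le
    -- The 5 comes from 1 + ‖w‖ ≤ 5‖w‖, valid for ‖w‖ > 1/4.
    have h2 : (‖w‖ ^ (q - 1))⁻¹ ≤ 5 ^ (q - 1) * (1 + ‖w‖) ^ (-(q - 1)) := by
      rw [Real.rpow_neg (by positivity), ← div_eq_mul_inv, le_div_iff₀ (by positivity),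
        inv_mul_le_iff₀ (by positivity), ← Real.mul_rpow (by positivity) (by positivity)]
      exact Real.rpow_le_rpow (by positivity) (by linarith) (by linarith)
    calc (gauge K w ^ q)⁻¹ * (4 * ‖w‖) ≤ R ^ q * (‖w‖ ^ q)⁻¹ * (4 * ‖w‖) := by gcongr
      _ = 4 * R ^ q * (‖w‖ ^ (q - 1))⁻¹ := by
        rw [Real.rpow_sub_one hw0.ne']; field_simp
      _ ≤ 4 * R ^ q * (5 ^ (q - 1) * (1 + ‖w‖) ^ (-(q - 1))) := by gcongr
      _ = _ := by ring
  · rw [Set.indicator_of_notMem (by exact hw), mul_zero]; exact bot_le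

/-- Rescale w by 1/a: the kernel contributes a^{N+p} and the Jacobian a^{-N}. -/
theorem lintegral_kernel_mul_indicator (hp : 1 < p) {a : ENNReal} (ha : a ≠ ⊤) :
    ∫⁻ w : RN N, kernel p K w * {w : RN N | 1 < 4 * ‖w‖ₑ * a}.indicator (fun w => 4 * ‖w‖ₑ * a) w
      = a ^ p *
      ∫⁻ w : RN N, kernel p K w * {w : RN N | 1 < 4 * ‖w‖ₑ}.indicator (fun w => 4 * ‖w‖ₑ) w := by
  have h0 : 0 < p := by linarith
  rcases eq_or_ne a 0 with rfl | ha0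
  · simp [ENNReal.zero_rpow_of_pos h0]
  lift a to NNReal using ha
  have ha' : 0 < a := by simpa [pos_iff_ne_zero] using ha0
  have har : (0 : ℝ) < (a : ℝ)⁻¹ := by positivity
  have hen : ∀ w : RN N, 4 * ‖(a : ℝ)⁻¹ • w‖ₑ * a = 4 * ‖w‖ₑ := fun w => by
    rw [enorm_smul, mul_comm ‖(a : ℝ)⁻¹‖ₑ, ← mul_assoc, mul_assoc]
    have : ‖(a : ℝ)⁻¹‖ₑ * a = 1 := by
      rw [← ofReal_norm, Real.norm_of_nonneg har.le, ← ENNReal.ofReal_coe_nnreal,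
        ← ENNReal.ofReal_mul har.le, inv_mul_cancel₀ (by positivity), ENNReal.ofReal_one]
    rw [this, mul_one]
  rw [lintegral_eq_mul_lintegral_comp_smul _ har, ← lintegral_const_mul' _ _ ENNReal.ofReal_ne_top,
    ← lintegral_const_mul' _ _ (ENNReal.rpow_ne_top_of_nonneg h0.le ENNReal.coe_ne_top)]
  refine lintegral_congr fun w => ?_
  simp only [Set.indicator, Set.mem_ofPred_eq, hen]
  rw [kernel_smul har, ← mul_assoc, ← mul_assoc, ← mul_assoc, ← ENNReal.ofReal_mul (by positivity)]
  congr 2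
  rw [← ENNReal.ofReal_coe_nnreal, ENNReal.ofReal_rpow_of_pos (by positivity)]
  congr 1
  have ha2 : (0 : ℝ) < a := ha'
  rw [Real.rpow_add har, Real.rpow_natCast, Real.inv_rpow ha2.le]
  field_simp

/-- By Tonelli the w-integral can be done first; by scaling it equals a fixed constant times F(x)^p.
-/
theorem IsNormUnitBall.lintegral_kernel_truncated_lt_top (hK : IsNormUnitBall K) (hp : 1 < p)
    {F : RN N → ENNReal} (hF : Measurable F) (hFp : ∫⁻ x, F x ^ p < ⊤) :
    ∫⁻ w, kernel p K w *
      ∫⁻ x, {x | 1 < 4 * ‖w‖ₑ * F x}.indicator (fun x => 4 * ‖w‖ₑ * F x) x < ⊤ := by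
  have h0 : 0 < p := by linarith
  have hk := hK.measurable_kernel (p := p)
  have hm : Measurable fun q : RN N × RN N => kernel p K q.1 *
      {q : RN N × RN N | 1 < 4 * ‖q.1‖ₑ * F q.2}.indicator (fun q => 4 * ‖q.1‖ₑ * F q.2) q := by
    have h1 : Measurable fun q : RN N × RN N => 4 * ‖q.1‖ₑ * F q.2 := by fun_prop
    exact (hk.comp measurable_fst).mul (h1.indicator (measurableSet_lt measurable_const h1))
  have hfin : ∀ᵐ x, F x ≠ ⊤ := by
    filter_upwards [ae_lt_top (by fun_prop) hFp.ne] with x hx h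
    simp [h, h0] at hx
  have e2 : ∀ w, kernel p K w *
      ∫⁻ x, {x | 1 < 4 * ‖w‖ₑ * F x}.indicator (fun x => 4 * ‖w‖ₑ * F x) x
      = ∫⁻ x, kernel p K w * {q : RN N × RN N | 1 < 4 * ‖q.1‖ₑ * F q.2}.indicator
        (fun q => 4 * ‖q.1‖ₑ * F q.2) (w, x) := fun w => by
    rw [lintegral_const_mul' _ _ (by exact ENNReal.ofReal_ne_top)]; rfl
  simp_rw [e2]
  rw [lintegral_lintegral_swap hm.aemeasurable]
  calc _ = ∫⁻ x, F x ^ p * ∫⁻ w : RN N, kernel p K w *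
            {w : RN N | 1 < 4 * ‖w‖ₑ}.indicator (fun w => 4 * ‖w‖ₑ) w := by
        refine lintegral_congr_ae ?_
        filter_upwards [hfin] with x hx
        exact lintegral_kernel_mul_indicator hp hx
    _ < ⊤ := by
        rw [lintegral_mul_const _ (by fun_prop)]
        exact ENNReal.mul_lt_top hFp (hK.lintegral_kernel_mul_norm_lt_top hp)

end Domination
-- L^p expansion and convergence of superlevel measures.
section Convergence

variable {N : ℕ} {A : RN N → RN N} {u : RN N → ℂ} {G : RN N → CN N} {p : ℝ}

theorem lintegral_Ioc_rpow_le (hp : 1 < p) {f : ℝ → ENNReal} (hf : Measurable f) :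
    (∫⁻ t in Set.Ioc (0 : ℝ) 1, f t) ^ p ≤ ∫⁻ t in Set.Ioc (0 : ℝ) 1, f t ^ p := by
  have h0 : 0 < p := by linarith
  have h := ENNReal.lintegral_mul_le_Lp_mul_Lq (volume.restrict (Set.Ioc (0 : ℝ) 1))
    (Real.HolderConjugate.conjExponent hp) hf.aemeasurable (g := fun _ => 1) aemeasurable_const
  simp only [Pi.mul_apply, mul_one, ENNReal.one_rpow, lintegral_one, Measure.restrict_apply_univ,
    Real.volume_Ioc, sub_zero, ENNReal.ofReal_one] at h
  calc _ ≤ ((∫⁻ t in Set.Ioc (0 : ℝ) 1, f t ^ p) ^ (1 / p)) ^ p := ENNReal.rpow_le_rpow h h0.le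
    _ = _ := by rw [← ENNReal.rpow_mul, one_div_mul_cancel h0.ne', ENNReal.rpow_one]

theorem memLp_of_lintegral_rpow_lt_top {F : Type*} [NormedAddCommGroup F] (hp : 1 < p)
    {V : RN N → F} (hV : StronglyMeasurable V) (hVp : ∫⁻ x, ‖V x‖ₑ ^ p < ⊤) :
    MemLp V (ENNReal.ofReal p) := by
  have h0 : 0 < p := by linarith
  refine ⟨hV.aestronglyMeasurable, ?_⟩
  rw [eLpNorm_lt_top_iff_lintegral_rpow_enorm_lt_top (by simpa using h0) ENNReal.ofReal_ne_top,
    ENNReal.toReal_ofReal h0.le]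
  exact hVp

/-- Continuity of translations in `L^p`. -/
theorem tendsto_lintegral_translate_sub {F : Type*} [NormedAddCommGroup F] (hp : 1 < p)
    {V : RN N → F} (hV : StronglyMeasurable V) (hVp : ∫⁻ x, ‖V x‖ₑ ^ p < ⊤) :
    Tendsto (fun h : RN N => ∫⁻ x, ‖V (x + h) - V x‖ₑ ^ p) (𝓝 0) (𝓝 0) := by
  have h0 : 0 < p := by linarith
  have : Fact (1 ≤ ENNReal.ofReal p) := ⟨by simpa using hp.le⟩
  have hmem := memLp_of_lintegral_rpow_lt_top hp hV hVp
  -- Currying makes translations a continuous family of measure-preserving maps, and composition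
  -- with such a family is continuous in L^p.
  set g : C(RN N, C(RN N, RN N)) :=
    ContinuousMap.curry ⟨fun q : RN N × RN N => q.2 + q.1, by fun_prop⟩ with hg
  have hgm : ∀ h, MeasurePreserving (g h) (volume : Measure (RN N)) volume := fun h =>
    measurePreserving_add_right volume h
  have hc : Continuous fun h => Lp.compMeasurePreserving (g h) (hgm h) (hmem.toLp V) :=
    continuous_const.compMeasurePreservingLp g.continuous hgm ENNReal.ofReal_ne_top
  have h1 := tendsto_iff_edist_tendsto_0.1 (hc.tendsto 0)
  have h2 := ((ENNReal.continuous_rpow_const (y := p)).tendsto 0).comp h1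
  rw [ENNReal.zero_rpow_of_pos h0] at h2
  refine h2.congr fun h => ?_
  have e : ∀ h, ⇑(Lp.compMeasurePreserving (g h) (hgm h) (hmem.toLp V)) =ᵐ[volume]
      fun x => V (x + h) := fun h =>
    (Lp.coeFn_compMeasurePreserving _ (hgm h)).trans
      ((hgm h).quasiMeasurePreserving.ae_eq_comp hmem.coeFn_toLp)
  rw [Function.comp_apply, Lp.edist_def, eLpNorm_congr_ae ((e h).sub (e 0)),
    eLpNorm_eq_lintegral_rpow_enorm_toReal (by simpa using h0) ENNReal.ofReal_ne_top,
    ENNReal.toReal_ofReal h0.le, ← ENNReal.rpow_mul, one_div_mul_cancel h0.ne', ENNReal.rpow_one]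
  simp

theorem add_add_rpow_le (hp : 1 < p) (a b c : ENNReal) :
    (a + (b + c)) ^ p ≤ 2 ^ (p - 1) * (a ^ p + 2 ^ (p - 1) * (b ^ p + c ^ p)) := by
  refine (ENNReal.rpow_add_le_mul_rpow_add_rpow a (b + c) hp.le).trans ?_
  gcongr
  exact ENNReal.rpow_add_le_mul_rpow_add_rpow b c hp.le

theorem tendsto_lintegral_Ioc_smul {ω : RN N → ENNReal} (hω : Tendsto ω (𝓝 0) (𝓝 0)) :
    Tendsto (fun z : RN N => ∫⁻ t in Set.Ioc (0 : ℝ) 1, ω (t • z)) (𝓝 0) (𝓝 0) := by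
  rw [ENNReal.tendsto_nhds_zero] at hω ⊢
  intro ε hε
  obtain ⟨r, hr, hr2⟩ := Metric.eventually_nhds_iff_ball.1 (hω ε hε)
  filter_upwards [Metric.ball_mem_nhds (0 : RN N) hr] with z hz
  calc ∫⁻ t in Set.Ioc (0 : ℝ) 1, ω (t • z) ≤ ∫⁻ t in Set.Ioc (0 : ℝ) 1, ε := by
        refine setLIntegral_mono' measurableSet_Ioc fun t ht => hr2 _ ?_
        rw [mem_ball_zero_iff] at hz ⊢
        rw [norm_smul, Real.norm_of_nonneg ht.1.le]
        exact (mul_le_of_le_one_left (norm_nonneg _) ht.2).trans_lt hz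
    _ = ε := by simp

/-- Each of the three errors tends to 0: the oscillation by L^p-continuity of translations, the
phase term by dominated convergence under 2^p|V|^p, the Lipschitz term through its factor ‖z‖.
Jensen's inequality on the unit interval carries the segment averages to L^p. -/
theorem IsWeakGradient.exists_modulus (h : IsWeakGradient u G) (hu : StronglyMeasurable u)
    (hG : StronglyMeasurable G) {L : NNReal} (hA : LipschitzWith L A) (hp : 1 < p)
    (hup : ∫⁻ x, ‖u x‖ₑ ^ p < ⊤) (hVp : ∫⁻ x, ‖magGrad A u G x‖ₑ ^ p < ⊤) :
    ∃ E : RN N → ENNReal, Tendsto E (𝓝 0) (𝓝 0) ∧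
      ∀ z, ∫⁻ x, ‖psiDiff A u z x - cdot (magGrad A u G x) z‖ₑ ^ p ≤ ‖z‖ₑ ^ p * E z := by
  have h0 : 0 < p := by linarith
  have hVs := stronglyMeasurable_magGrad hA.continuous hu hG
  set V := magGrad A u G with hV
  have hVm := hVs.measurable
  have hum := hu.measurable
  have hAc := hA.continuous
  set ω : RN N → ENNReal := fun h => ∫⁻ x, ‖V (x + h) - V x‖ₑ ^ p with hω
  set θ : RN N → RN N → ENNReal := fun z x =>
    ENNReal.ofReal (min 2 |inner ℝ z (A (x + (1 / 2 : ℝ) • z))|) with hθ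
  set C : ENNReal := 2 ^ (p - 1) with hC
  have hCt : C ≠ ⊤ := ENNReal.rpow_ne_top_of_nonneg (by linarith) (by simp)
  have hθm : ∀ z, Measurable (θ z) := fun z => by
    have : Continuous (θ z) := ENNReal.continuous_ofReal.comp (by fun_prop)
    exact this.measurable
  refine ⟨fun z => C * ((∫⁻ t in Set.Ioc (0 : ℝ) 1, ω (t • z)) + C * ((∫⁻ x, (θ z x * ‖V x‖ₑ) ^ p)
    + (L * ‖z‖ₑ) ^ p * ∫⁻ x, ‖u x‖ₑ ^ p)), ?_, fun z => ?_⟩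
  · have h1 : Tendsto (fun z : RN N => ∫⁻ t in Set.Ioc (0 : ℝ) 1, ω (t • z)) (𝓝 0) (𝓝 0) :=
      tendsto_lintegral_Ioc_smul (tendsto_lintegral_translate_sub hp hVs hVp)
    have h2 : Tendsto (fun z : RN N => ∫⁻ x, (θ z x * ‖V x‖ₑ) ^ p) (𝓝 0) (𝓝 0) := by
      have hlim : ∀ x, Tendsto (fun z => (θ z x * ‖V x‖ₑ) ^ p) (𝓝 0) (𝓝 0) := fun x => by
        have hc : Continuous fun z => θ z x := ENNReal.continuous_ofReal.comp (by fun_prop)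
        have h3 : Tendsto (fun z => θ z x * ‖V x‖ₑ) (𝓝 0) (𝓝 (θ 0 x * ‖V x‖ₑ)) :=
          ENNReal.Tendsto.mul_const (hc.tendsto 0) (Or.inr enorm_ne_top)
        have h4 : θ 0 x = 0 := by simp [hθ]
        rw [h4, zero_mul] at h3
        have h5 := ((ENNReal.continuous_rpow_const (y := p)).tendsto 0).comp h3
        rwa [ENNReal.zero_rpow_of_pos h0] at h5
      have h3 := tendsto_lintegral_filter_of_dominated_convergence (μ := volume) (l := 𝓝 (0 : RN N))
        (F := fun z x => (θ z x * ‖V x‖ₑ) ^ p) (f := fun _ => 0)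
        (fun x => 2 ^ p * ‖V x‖ₑ ^ p) (Eventually.of_forall fun z => by
          have := hθm z; fun_prop)
        (Eventually.of_forall fun z => ae_of_all _ fun x => by
          rw [← ENNReal.mul_rpow_of_nonneg _ _ h0.le]
          gcongr
          rw [← ENNReal.ofReal_ofNat 2]
          exact ENNReal.ofReal_le_ofReal (min_le_left _ _))
        (by
          rw [lintegral_const_mul' _ _ (ENNReal.rpow_ne_top_of_nonneg h0.le (by simp))]
          exact ENNReal.mul_ne_top (ENNReal.rpow_ne_top_of_nonneg h0.le (by simp)) hVp.ne)
        (ae_of_all _ hlim)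
      simpa using h3
    have h3 : Tendsto (fun z : RN N => (L * ‖z‖ₑ) ^ p * ∫⁻ x, ‖u x‖ₑ ^ p) (𝓝 0) (𝓝 0) := by
      have h4 : Tendsto (fun z : RN N => (L : ENNReal) * ‖z‖ₑ) (𝓝 0) (𝓝 (L * ‖(0 : RN N)‖ₑ)) :=
        ENNReal.Tendsto.const_mul (continuous_enorm.tendsto 0) (Or.inr ENNReal.coe_ne_top)
      rw [enorm_zero, mul_zero] at h4
      have h5 := ((ENNReal.continuous_rpow_const (y := p)).tendsto 0).comp h4
      rw [ENNReal.zero_rpow_of_pos h0] at h5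
      simpa using ENNReal.Tendsto.mul_const h5 (Or.inr hup.ne)
    have h4 := ENNReal.Tendsto.const_mul (a := C)
      (h1.add (ENNReal.Tendsto.const_mul (a := C) (h2.add h3) (Or.inr hCt))) (Or.inr hCt)
    simpa using h4
  · have e1 : ∫⁻ x, ‖psiDiff A u z x - cdot (V x) z‖ₑ ^ p
        ≤ ∫⁻ x, ‖z‖ₑ ^ p * ∫⁻ t in Set.Ioc (0 : ℝ) 1, C * (‖V (x + t • z) - V x‖ₑ ^ p
          + C * ((θ z x * ‖V x‖ₑ) ^ p + (L * ‖z‖ₑ) ^ p * ‖u (x + t • z)‖ₑ ^ p)) := by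
      refine lintegral_mono_ae ?_
      filter_upwards [h.enorm_psiDiff_sub_le hu hG hA z] with x hx
      refine (ENNReal.rpow_le_rpow hx h0.le).trans ?_
      rw [ENNReal.mul_rpow_of_nonneg _ _ h0.le]
      gcongr
      refine (lintegral_Ioc_rpow_le hp (by rw [← hV]; fun_prop)).trans (lintegral_mono fun t => ?_)
      refine (add_add_rpow_le hp _ _ _).trans ?_
      rw [ENNReal.mul_rpow_of_nonneg (L * ‖z‖ₑ) _ h0.le]
    refine e1.trans (le_of_eq ?_)
    have hθz := hθm z
    have hcomp : ∀ f : RN N → ENNReal, Measurable f →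
        Measurable fun q : RN N × ℝ => f (q.1 + q.2 • z) := fun f hf => by fun_prop
    rw [lintegral_const_mul' _ _ (ENNReal.rpow_ne_top_of_nonneg h0.le enorm_ne_top)]
    congr 1
    rw [lintegral_lintegral_swap (by fun_prop)]
    have e2 : ∀ t : ℝ, ∫⁻ x, C * (‖V (x + t • z) - V x‖ₑ ^ p
          + C * ((θ z x * ‖V x‖ₑ) ^ p + (L * ‖z‖ₑ) ^ p * ‖u (x + t • z)‖ₑ ^ p))
        = C * (ω (t • z) + C * ((∫⁻ x, (θ z x * ‖V x‖ₑ) ^ p)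
          + (L * ‖z‖ₑ) ^ p * ∫⁻ x, ‖u x‖ₑ ^ p)) := by
      intro t
      rw [lintegral_const_mul' _ _ hCt, lintegral_add_left (by fun_prop),
        lintegral_const_mul' _ _ hCt, lintegral_add_left (by fun_prop),
        lintegral_const_mul _ (by fun_prop),
        lintegral_add_right_eq_self (fun x => ‖u x‖ₑ ^ p) (t • z)]
    simp_rw [e2]
    rw [lintegral_const_mul' _ _ hCt, lintegral_add_right _ measurable_const]
    simp

/-- Convergence in measure implies convergence of the measures of a superlevel set whose level
is not charged by the limit. -/
theorem tendsto_measure_one_lt {X ι : Type*} [MeasurableSpace X] {μ : Measure X} {l : Filter ι}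
    {f : ι → X → ℝ} {g : X → ℝ} (hg : Measurable g) (hfg : TendstoInMeasure μ f l g)
    (h1 : μ {x | g x = 1} = 0) (hfin : ∀ c : ℝ, 0 < c → μ {x | c < g x} < ⊤) :
    Tendsto (fun i => μ {x | 1 < f i x}) l (𝓝 (μ {x | 1 < g x})) := by
  have hη : ∀ η : ℝ, 0 < η → Tendsto (fun i => μ {x | η ≤ |f i x - g x|}) l (𝓝 0) :=
    fun η h => by simpa only [Real.norm_eq_abs] using tendstoInMeasure_iff_norm.1 hfg η h
  -- The shift by 2 keeps 1 - η n positive from n = 0 on, so the sets decreasing to {1 ≤ g} have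
  -- finite measure.
  set η : ℕ → ℝ := fun n => 1 / ((n : ℝ) + 2) with hηdef
  have hη0 : ∀ n, 0 < η n := fun n => by positivity
  have hηanti : Antitone η := fun m n hmn => by
    simp only [hηdef]; gcongr
  have hηlim : Tendsto η atTop (𝓝 0) := by
    have := (tendsto_one_div_add_atTop_nhds_zero_nat (𝕜 := ℝ)).comp (tendsto_add_atTop_nat 1)
    refine this.congr fun n => ?_
    simp only [Function.comp_apply, hηdef]; push_cast; ring_nf
  refine tendsto_order.2 ⟨fun a ha => ?_, fun b hb => ?_⟩
  · have hU : {x | 1 < g x} = ⋃ n, {x | 1 + η n < g x} := by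
      ext x
      simp only [Set.mem_ofPred_eq, Set.mem_iUnion]
      refine ⟨fun hx => ?_, fun ⟨n, hn⟩ => by linarith [hη0 n]⟩
      obtain ⟨n, hn⟩ := (hηlim.eventually_lt_const (sub_pos.2 hx)).exists
      exact ⟨n, by linarith⟩
    have ht := tendsto_measure_iUnion_atTop (μ := μ) (s := fun n => {x | 1 + η n < g x})
      fun m n hmn x hx => by
        simp only [Set.mem_ofPred_eq] at hx ⊢
        linarith [hηanti hmn]
    rw [← hU] at ht
    obtain ⟨n, hn⟩ := (ht.eventually_const_lt ha).exists
    have h2 : Tendsto (fun i => μ {x | 1 + η n < g x} - μ {x | η n ≤ |f i x - g x|}) l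
        (𝓝 (μ {x | 1 + η n < g x} - 0)) :=
      ENNReal.Tendsto.sub tendsto_const_nhds (hη _ (hη0 n)) (Or.inr ENNReal.zero_ne_top)
    rw [tsub_zero] at h2
    filter_upwards [h2.eventually_const_lt hn] with i hi
    refine hi.trans_le (tsub_le_iff_right.2 ((measure_mono fun x hx => ?_).trans
      (measure_union_le _ _)))
    by_cases hx2 : η n ≤ |f i x - g x|
    · exact Or.inr hx2
    · left
      have := (abs_lt.1 (not_le.1 hx2)).1
      simp only [Set.mem_ofPred_eq] at hx ⊢
      linarith
  · have hI : {x | 1 ≤ g x} = ⋂ n, {x | 1 - η n < g x} := by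
      ext x
      simp only [Set.mem_ofPred_eq, Set.mem_iInter]
      refine ⟨fun hx n => by linarith [hη0 n], fun hx => ?_⟩
      by_contra! hlt
      obtain ⟨n, hn⟩ := (hηlim.eventually_lt_const (sub_pos.2 hlt)).exists
      linarith [hx n]
    have ht := tendsto_measure_iInter_atTop (μ := μ) (s := fun n => {x | 1 - η n < g x})
      (fun n => (measurableSet_lt measurable_const hg).nullMeasurableSet)
      (fun m n hmn x hx => by
        simp only [Set.mem_ofPred_eq] at hx ⊢
        linarith [hηanti hmn])
      ⟨0, (hfin _ (by norm_num [hηdef])).ne⟩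
    -- Only the upper bound uses that the level 1 is not charged; the lower bound is continuity from
    -- below.
    have hle : μ {x | 1 ≤ g x} ≤ μ {x | 1 < g x} := by
      calc μ {x | 1 ≤ g x} ≤ μ ({x | 1 < g x} ∪ {x | g x = 1}) :=
            measure_mono fun x hx => (lt_or_eq_of_le (show 1 ≤ g x from hx)).imp id Eq.symm
        _ ≤ μ {x | 1 < g x} + μ {x | g x = 1} := measure_union_le _ _
        _ = μ {x | 1 < g x} := by rw [h1, add_zero]
    rw [← hI] at ht
    obtain ⟨n, hn⟩ := (ht.eventually_lt_const (hle.trans_lt hb)).exists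
    have h2 : Tendsto (fun i => μ {x | 1 - η n < g x} + μ {x | η n ≤ |f i x - g x|}) l
        (𝓝 (μ {x | 1 - η n < g x} + 0)) := tendsto_const_nhds.add (hη _ (hη0 n))
    rw [add_zero] at h2
    filter_upwards [h2.eventually_lt_const hn] with i hi
    refine ((measure_mono fun x hx => ?_).trans (measure_union_le _ _)).trans_lt hi
    by_cases hx2 : η n ≤ |f i x - g x|
    · exact Or.inr hx2
    · left
      have := (abs_lt.1 (not_le.1 hx2)).2
      simp only [Set.mem_ofPred_eq] at hx ⊢
      linarith

theorem abs_absP_sub_le (hp : 1 < p) (z w : ℂ) : |absP p z - absP p w| ≤ 2 * ‖z - w‖ := by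
  have h1 := absP_add_le hp (z - w) w
  have h2 := absP_add_le hp (w - z) z
  have h3 := absP_le_two_mul_norm hp (z - w)
  have h4 := absP_le_two_mul_norm hp (w - z)
  rw [sub_add_cancel] at h1 h2
  rw [norm_sub_rev] at h4
  rw [abs_le]
  constructor <;> linarith

theorem measurable_psiDiff (hA : Continuous A) (hu : Measurable u) :
    Measurable fun q : RN N × RN N => psiDiff A u q.1 q.2 := by
  have : (fun q : RN N × RN N => psiDiff A u q.1 q.2) = fun q => Complex.exp (-(Complex.I *
      ((inner ℝ q.1 (A (q.2 + (1 / 2 : ℝ) • q.1)) : ℝ) : ℂ))) * u (q.2 + q.1) - u q.2 := by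
    funext q
    rw [psiDiff, Psi_add, Psi_self]
  rw [this]
  have h1 : Continuous fun q : RN N × RN N => Complex.exp (-(Complex.I *
      ((inner ℝ q.1 (A (q.2 + (1 / 2 : ℝ) • q.1)) : ℝ) : ℂ))) := by fun_prop
  have := h1.measurable
  fun_prop

theorem measurable_psiDiff_right (hA : Continuous A) (hu : Measurable u) (z : RN N) :
    Measurable (psiDiff A u z) :=
  (measurable_psiDiff hA hu).comp (f := fun x => (z, x)) (measurable_const.prodMk measurable_id)

theorem measure_lt_absP_cdot_lt_top (hp : 1 < p) {V : RN N → CN N} (hV : Measurable V)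
    (hVp : ∫⁻ x, ‖V x‖ₑ ^ p < ⊤) (w : RN N) {c : ℝ} (hc : 0 < c) :
    volume {x | c < absP p (cdot (V x) w)} < ⊤ := by
  have h0 : 0 < p := by linarith
  have hcp : ENNReal.ofReal (c ^ p) ≠ 0 := by simpa using Real.rpow_pos_of_pos hc p
  have hle : ∀ x, c < absP p (cdot (V x) w) →
      ENNReal.ofReal (c ^ p) ≤ (2 * ‖w‖ₑ) ^ p * ‖V x‖ₑ ^ p := by
    intro x hx
    have h1 : c ≤ 2 * ‖w‖ * ‖V x‖ := by
      have := absP_le_two_mul_norm hp (cdot (V x) w)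
      have := norm_cdot_le (V x) w
      linarith
    rw [← ENNReal.mul_rpow_of_nonneg _ _ h0.le, ← ENNReal.ofReal_rpow_of_pos hc]
    refine ENNReal.rpow_le_rpow ?_ h0.le
    refine (ENNReal.ofReal_le_ofReal h1).trans (le_of_eq ?_)
    rw [ENNReal.ofReal_mul (by positivity), ENNReal.ofReal_mul (by norm_num), ENNReal.ofReal_ofNat,
      ofReal_norm, ofReal_norm]
  refine (measure_mono (t := {x | ENNReal.ofReal (c ^ p) ≤ (2 * ‖w‖ₑ) ^ p * ‖V x‖ₑ ^ p}) hle).trans_lt ?_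
  refine (meas_ge_le_lintegral_div (by fun_prop) hcp ENNReal.ofReal_ne_top).trans_lt ?_
  rw [lintegral_const_mul _ (by fun_prop)]
  exact ENNReal.div_lt_top (ENNReal.mul_ne_top (ENNReal.rpow_ne_top_of_nonneg h0.le
    (ENNReal.mul_ne_top (by simp) enorm_ne_top)) hVp.ne) hcp

theorem _root_.Measurable.cdot_const {V : RN N → CN N} (hV : Measurable V) (z : RN N) :
    Measurable fun x => cdot (V x) z :=
  (measurable_cdot (N := N)).comp (f := fun x => (V x, z)) (hV.prodMk measurable_const)

theorem measurable_absP_cdot (hp : 1 < p) {V : RN N → CN N} (hV : Measurable V) (z : RN N) :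
    Measurable fun x => absP p (cdot (V x) z) :=
  (continuous_absP hp).measurable.comp (hV.cdot_const z)

/-- Chebyshev's inequality with the modulus E at z = δw: the factor ‖δw‖^p cancels the δ^p coming
from division by δ. -/
theorem IsWeakGradient.tendstoInMeasure_psiDiff_div (h : IsWeakGradient u G)
    (hu : StronglyMeasurable u) (hG : StronglyMeasurable G) {L : NNReal} (hA : LipschitzWith L A)
    (hp : 1 < p) (hup : ∫⁻ x, ‖u x‖ₑ ^ p < ⊤) (hVp : ∫⁻ x, ‖magGrad A u G x‖ₑ ^ p < ⊤) (w : RN N) :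
    TendstoInMeasure volume (fun (δ : ℝ) x => absP p (psiDiff A u (δ • w) x) / δ) (𝓝[>] 0)
      (fun x => absP p (cdot (magGrad A u G x) w)) := by
  have h0 : 0 < p := by linarith
  obtain ⟨E, hE, hEz⟩ := h.exists_modulus hu hG hA hp hup hVp
  have hVm := (stronglyMeasurable_magGrad hA.continuous hu hG).measurable
  set V := magGrad A u G with hV
  have hcm : ∀ z, Measurable fun x => cdot (V x) z := fun z =>
    hVm.cdot_const z
  rw [tendstoInMeasure_iff_norm]
  intro η hη
  set C : ENNReal := (2 * ‖w‖ₑ) ^ p / ENNReal.ofReal (η ^ p) with hC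
  have hηp : ENNReal.ofReal (η ^ p) ≠ 0 := by simpa using Real.rpow_pos_of_pos hη p
  have hCt : C ≠ ⊤ := ENNReal.div_ne_top (ENNReal.rpow_ne_top_of_nonneg h0.le
    (ENNReal.mul_ne_top (by simp) enorm_ne_top)) hηp
  have hlim : Tendsto (fun δ : ℝ => C * E (δ • w)) (𝓝[>] 0) (𝓝 0) := by
    have h1 : Tendsto (fun δ : ℝ => δ • w) (𝓝[>] 0) (𝓝 0) := by
      have : Continuous fun δ : ℝ => δ • w := by fun_prop
      have h2 := this.tendsto 0
      rw [zero_smul] at h2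
      exact h2.mono_left nhdsWithin_le_nhds
    simpa using ENNReal.Tendsto.const_mul (hE.comp h1) (Or.inr hCt)
  refine tendsto_of_tendsto_of_tendsto_of_le_of_le' tendsto_const_nhds hlim
    (Eventually.of_forall fun _ => zero_le) ?_
  filter_upwards [self_mem_nhdsWithin] with δ hδ
  have hδ : 0 < δ := hδ
  have hle : ∀ x, η ≤ ‖absP p (psiDiff A u (δ • w) x) / δ - absP p (cdot (V x) w)‖ →
      ENNReal.ofReal ((η * δ) ^ p) ≤ 2 ^ p * ‖psiDiff A u (δ • w) x - cdot (V x) (δ • w)‖ₑ ^ p := by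
    intro x hx
    have e1 : absP p (psiDiff A u (δ • w) x) / δ - absP p (cdot (V x) w)
        = (absP p (psiDiff A u (δ • w) x) - absP p (cdot (V x) (δ • w))) / δ := by
      rw [cdot_smul, absP_real_mul hp, abs_of_pos hδ]; field_simp
    rw [e1, norm_div, Real.norm_of_nonneg hδ.le, le_div_iff₀ hδ, Real.norm_eq_abs] at hx
    have h1 := hx.trans (abs_absP_sub_le hp _ _)
    rw [← ENNReal.mul_rpow_of_nonneg _ _ h0.le, ← ENNReal.ofReal_rpow_of_pos (by positivity)]
    refine ENNReal.rpow_le_rpow ?_ h0.le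
    refine (ENNReal.ofReal_le_ofReal h1).trans (le_of_eq ?_)
    rw [ENNReal.ofReal_mul (by norm_num), ENNReal.ofReal_ofNat, ofReal_norm]
  have hm : Measurable fun x => ‖psiDiff A u (δ • w) x - cdot (V x) (δ • w)‖ₑ ^ p := by
    have h1 := measurable_psiDiff_right hA.continuous hu.measurable (δ • w)
    have := hcm (δ • w)
    fun_prop
  have hδp : ENNReal.ofReal ((η * δ) ^ p) ≠ 0 := by
    simpa using Real.rpow_pos_of_pos (mul_pos hη hδ) p
  refine (measure_mono (t := {x | ENNReal.ofReal ((η * δ) ^ p)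
    ≤ 2 ^ p * ‖psiDiff A u (δ • w) x - cdot (V x) (δ • w)‖ₑ ^ p}) hle).trans ?_
  refine (meas_ge_le_lintegral_div (hm.const_mul _).aemeasurable hδp ENNReal.ofReal_ne_top).trans ?_
  rw [lintegral_const_mul _ hm]
  refine ENNReal.div_le_of_le_mul ((mul_le_mul_right (hEz (δ • w)) _).trans (le_of_eq ?_))
  have e3 : ‖δ • w‖ₑ ^ p = ENNReal.ofReal (δ ^ p) * ‖w‖ₑ ^ p := by
    rw [enorm_smul, ENNReal.mul_rpow_of_nonneg _ _ h0.le, ← ofReal_norm δ,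
      Real.norm_of_nonneg hδ.le, ENNReal.ofReal_rpow_of_pos hδ]
  have e4 : ENNReal.ofReal ((η * δ) ^ p) = ENNReal.ofReal (η ^ p) * ENNReal.ofReal (δ ^ p) := by
    rw [Real.mul_rpow hη.le hδ.le, ENNReal.ofReal_mul (by positivity)]
  have e5 : C * ENNReal.ofReal (η ^ p) = 2 ^ p * ‖w‖ₑ ^ p := by
    rw [hC, ENNReal.div_mul_cancel hηp ENNReal.ofReal_ne_top, ENNReal.mul_rpow_of_nonneg _ _ h0.le]
  rw [e3, e4]
  calc _ = (2 ^ p * ‖w‖ₑ ^ p) * E (δ • w) * ENNReal.ofReal (δ ^ p) := by ring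
    _ = _ := by rw [← e5]; ring

theorem IsWeakGradient.tendsto_measure_superlevel (h : IsWeakGradient u G)
    (hu : StronglyMeasurable u) (hG : StronglyMeasurable G) {L : NNReal} (hA : LipschitzWith L A)
    (hp : 1 < p) (hup : ∫⁻ x, ‖u x‖ₑ ^ p < ⊤) (hVp : ∫⁻ x, ‖magGrad A u G x‖ₑ ^ p < ⊤) (w : RN N)
    (hw : volume {x | absP p (cdot (magGrad A u G x) w) = 1} = 0) :
    Tendsto (fun δ : ℝ => volume {x | δ < absP p (psiDiff A u (δ • w) x)}) (𝓝[>] 0)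
      (𝓝 (volume {x | 1 < absP p (cdot (magGrad A u G x) w)})) := by
  have hVm := (stronglyMeasurable_magGrad hA.continuous hu hG).measurable
  have hcm : Measurable fun x => absP p (cdot (magGrad A u G x) w) :=
    measurable_absP_cdot hp hVm w
  have key := h.tendstoInMeasure_psiDiff_div hu hG hA hp hup hVp w
  refine (tendsto_measure_one_lt hcm key hw
    fun c hc => measure_lt_absP_cdot_lt_top hp hVm hVp w hc).congr' ?_
  filter_upwards [self_mem_nhdsWithin] with δ hδ
  have hδ : 0 < δ := hδ
  simp only [one_lt_div hδ]

/-- For fixed v the set |v·w|_p = 1 lies in the frontier of the convex set |v·w|_p ≤ 1, since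
dilating w by r > 1 leaves that set; such a frontier is null. Fubini exchanges the roles of x and w.
-/
theorem ae_measure_level_eq_zero (hp : 1 < p) {V : RN N → CN N} (hV : Measurable V) :
    ∀ᵐ w, volume {x | absP p (cdot (V x) w) = 1} = 0 := by
  have hm : Measurable fun q : RN N × RN N => absP p (cdot (V q.2) q.1) :=
    (continuous_absP hp).measurable.comp
      (measurable_cdot.comp ((hV.comp measurable_snd).prodMk measurable_fst))
  have hs : MeasurableSet {q : RN N × RN N | absP p (cdot (V q.2) q.1) = 1} :=
    hm (measurableSet_singleton 1)
  have hnull : ∀ v : CN N, volume {w : RN N | absP p (cdot v w) = 1} = 0 := by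
    intro v
    have hconv : Convex ℝ {w : RN N | absP p (cdot v w) ≤ 1} := by
      intro x hx y hy a b ha hb hab
      have hx : absP p (cdot v x) ≤ 1 := hx
      have hy : absP p (cdot v y) ≤ 1 := hy
      change absP p (cdot v (a • x + b • y)) ≤ 1
      rw [cdot_add, cdot_smul, cdot_smul]
      refine (absP_add_le hp _ _).trans ?_
      rw [absP_real_mul hp, absP_real_mul hp, abs_of_nonneg ha, abs_of_nonneg hb]
      nlinarith
    refine measure_mono_null (fun w hw => ?_) (hconv.addHaar_frontier volume)
    have hw : absP p (cdot v w) = 1 := hw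
    refine ⟨subset_closure hw.le, fun hint => ?_⟩
    have hc : Tendsto (fun r : ℝ => r • w) (𝓝[>] 1) (𝓝 w) := by
      have : Continuous fun r : ℝ => r • w := by fun_prop
      have h2 := this.tendsto 1
      rw [one_smul] at h2
      exact h2.mono_left nhdsWithin_le_nhds
    obtain ⟨r, hr, hr1⟩ := ((hc.eventually (mem_interior_iff_mem_nhds.1 hint)).and self_mem_nhdsWithin).exists
    have hr1 : 1 < r := hr1
    have hr : absP p (cdot v (r • w)) ≤ 1 := hr
    rw [cdot_smul, absP_real_mul hp, hw, abs_of_pos (by linarith)] at hr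
    linarith
  have h1 : (volume.prod volume) {q : RN N × RN N | absP p (cdot (V q.2) q.1) = 1} = 0 := by
    rw [Measure.prod_apply_symm hs]
    simp only [Set.preimage, Set.mem_ofPred_eq, hnull, lintegral_zero]
  exact Measure.measure_ae_null_of_prod_null h1

end Convergence
-- Near and far parts, and the passage to the limit.
section Limit

variable {N : ℕ} {K : Set (RN N)} {A : RN N → RN N} {u u' : RN N → ℂ} {G G' : RN N → CN N} {p : ℝ}

theorem nonlocalFunctional_congr_ae (h : u =ᵐ[volume] u') (δ : ℝ) :
    nonlocalFunctional p K A u δ = nonlocalFunctional p K A u' δ := by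
  have h1 : ∀ᵐ w : RN N × RN N, u w.1 = u' w.1 := Measure.quasiMeasurePreserving_fst.ae h
  have h2 : ∀ᵐ w : RN N × RN N, u w.2 = u' w.2 := Measure.quasiMeasurePreserving_snd.ae h
  refine lintegral_congr_ae ?_
  filter_upwards [h1, h2] with w hw1 hw2
  simp only [Set.indicator, Set.mem_ofPred_eq, Psi, hw1, hw2]
  congr

theorem magEnergy_congr_ae (h : u =ᵐ[volume] u') (hG : G =ᵐ[volume] G') :
    magEnergy p K A u G = magEnergy p K A u' G' := by
  refine lintegral_congr_ae ?_
  filter_upwards [h, hG] with x hx hGx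
  simp only [magGrad, hx, hGx]

theorem IsWeakGradient.congr_ae (hw : IsWeakGradient u G) (h : u =ᵐ[volume] u')
    (hG : G =ᵐ[volume] G') : IsWeakGradient u' G' where
  locallyIntegrable := hw.locallyIntegrable.congr h
  locallyIntegrable_grad := hw.locallyIntegrable_grad.congr hG
  integral_eq φ hφ hφc j := by
    have e1 : ∫ x, ((fderiv ℝ φ x (EuclideanSpace.single j 1) : ℝ) : ℂ) * u' x
        = ∫ x, ((fderiv ℝ φ x (EuclideanSpace.single j 1) : ℝ) : ℂ) * u x :=
      integral_congr_ae (by filter_upwards [h] with x hx; rw [hx])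
    have e2 : ∫ x, ((φ x : ℝ) : ℂ) * G' x j = ∫ x, ((φ x : ℝ) : ℂ) * G x j :=
      integral_congr_ae (by filter_upwards [hG] with x hx; rw [hx])
    rw [e1, e2, hw.integral_eq φ hφ hφc j]

/-- Needed because membership in the Sobolev space supplies some gradient of finite energy, not a
prescribed one. -/
theorem IsWeakGradient.ae_eq (h : IsWeakGradient u G) (h' : IsWeakGradient u G') :
    G =ᵐ[volume] G' := by
  have hcoord : ∀ j, ∀ᵐ x, G x j = G' x j := by
    intro j
    have hloc : ∀ {H : RN N → CN N}, LocallyIntegrable H → LocallyIntegrable fun x => H x j :=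
      fun hH => by
        have := LocallyIntegrable.cdot hH (EuclideanSpace.single j (1 : ℝ))
        simpa [cdot, PiLp.single_apply, apply_ite Complex.ofReal] using this
    refine ae_eq_of_integral_contDiff_smul_eq (hloc h.locallyIntegrable_grad)
      (hloc h'.locallyIntegrable_grad) fun φ hφ hφc => ?_
    have := (h.integral_eq φ hφ hφc j).symm.trans (h'.integral_eq φ hφ hφc j)
    simpa [Complex.real_smul] using neg_injective this
  filter_upwards [ae_all_iff.2 hcoord] with x hx
  exact PiLp.ext hx

theorem measurable_superlevel (hA : Continuous A) (hu : Measurable u) (hp : 1 < p) (δ : ℝ) :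
    MeasurableSet {q : RN N × RN N | δ < absP p (psiDiff A u q.1 q.2)} :=
  measurableSet_lt measurable_const
    ((continuous_absP hp).measurable.comp (measurable_psiDiff hA hu))

theorem measurableSet_superlevel_fiber (hA : Continuous A) (hu : Measurable u) (hp : 1 < p) (z : RN N)
    (δ : ℝ) : MeasurableSet {x | δ < absP p (psiDiff A u z x)} :=
  measurableSet_lt measurable_const
    ((continuous_absP hp).measurable.comp (measurable_psiDiff_right hA hu z))

theorem measurable_measure_superlevel (hA : Continuous A) (hu : Measurable u) (hp : 1 < p) (δ : ℝ) :
    Measurable fun z => volume {x | δ < absP p (psiDiff A u z x)} :=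
  measurable_measure_prodMk_left (measurable_superlevel hA hu hp δ)

theorem IsNormUnitBall.nonlocalFunctional_eq (hK : IsNormUnitBall K) (hA : Continuous A)
    (hu : Measurable u) (hp : 1 < p) (δ : ℝ) :
    nonlocalFunctional p K A u δ = ∫⁻ z, kernel p K z *
      (ENNReal.ofReal (δ ^ p) * volume {x | δ < absP p (psiDiff A u z x)}) := by
  have hg := hK.continuous_gauge.measurable
  set F : RN N × RN N → ENNReal :=
    Set.indicator {w : RN N × RN N | δ < absP p (Psi A u w.1 w.2 - Psi A u w.1 w.1)}
      (fun w => ENNReal.ofReal (δ ^ p / gauge K (w.1 - w.2) ^ ((N : ℝ) + p))) with hF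
  have hFm : Measurable F := by
    have hs : {w : RN N × RN N | δ < absP p (Psi A u w.1 w.2 - Psi A u w.1 w.1)}
        = (fun w : RN N × RN N => (w.2 - w.1, w.1)) ⁻¹'
          {q : RN N × RN N | δ < absP p (psiDiff A u q.1 q.2)} := by
      ext w
      simp [psiDiff]
    rw [hF, hs]
    exact Measurable.indicator (by fun_prop) (measurable_superlevel hA hu hp δ |>.preimage (by fun_prop))
  have hFs : ∀ x z, F (x, x + z) = {x | δ < absP p (psiDiff A u z x)}.indicator
      (fun _ => kernel p K z * ENNReal.ofReal (δ ^ p)) x := by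
    intro x z
    have h1 : x - (x + z) = -z := by abel
    simp only [hF, Set.indicator, Set.mem_ofPred_eq, psiDiff, h1, gauge_neg hK.symmetric, kernel]
    rw [← ENNReal.ofReal_mul (inv_nonneg.2 (Real.rpow_nonneg (gauge_nonneg z) _)), div_eq_inv_mul]
    congr
  calc nonlocalFunctional p K A u δ = ∫⁻ x, ∫⁻ y, F (x, y) :=
        lintegral_prod _ hFm.aemeasurable
    _ = ∫⁻ x, ∫⁻ z, F (x, x + z) :=
        lintegral_congr fun x => (lintegral_add_left_eq_self (fun y => F (x, y)) x).symm
    _ = ∫⁻ z, ∫⁻ x, F (x, x + z) :=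
        lintegral_lintegral_swap (f := fun x z => F (x, x + z))
          (hFm.comp (by fun_prop : Measurable fun q : RN N × RN N => (q.1, q.1 + q.2))).aemeasurable
    _ = _ := by
        refine lintegral_congr fun z => ?_
        simp_rw [hFs]
        rw [lintegral_indicator_const (measurableSet_superlevel_fiber hA hu hp z δ), mul_assoc]

theorem rpow_mul_measure_superlevel_le (hA : Continuous A) (hu : Measurable u) (hp : 1 < p) (z : RN N)
    {δ : ℝ} (hδ : 0 < δ) :
    ENNReal.ofReal (δ ^ p) * volume {x | δ < absP p (psiDiff A u z x)}
      ≤ ∫⁻ x, (2 * ‖psiDiff A u z x‖ₑ) ^ p := by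
  have h0 : 0 < p := by linarith
  have hm := measurable_psiDiff_right hA hu z
  refine le_trans ?_ (mul_meas_ge_le_lintegral (f := fun x => (2 * ‖psiDiff A u z x‖ₑ) ^ p)
    (by fun_prop) (ENNReal.ofReal (δ ^ p)))
  refine mul_le_mul_right (measure_mono fun x hx => ?_) _
  have hx : δ < absP p (psiDiff A u z x) := hx
  have h1 := hx.le.trans (absP_le_two_mul_norm hp _)
  change ENNReal.ofReal (δ ^ p) ≤ (2 * ‖psiDiff A u z x‖ₑ) ^ p
  rw [← ENNReal.ofReal_rpow_of_pos hδ]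
  refine ENNReal.rpow_le_rpow ((ENNReal.ofReal_le_ofReal h1).trans (le_of_eq ?_)) h0.le
  rw [ENNReal.ofReal_mul (by norm_num), ENNReal.ofReal_ofNat, ofReal_norm]

theorem lintegral_psiDiff_rpow_le (A : RN N → RN N) (hu : Measurable u) (hp : 1 < p) (z : RN N) :
    ∫⁻ x, (2 * ‖psiDiff A u z x‖ₑ) ^ p ≤ 2 ^ p * 2 ^ p * ∫⁻ x, ‖u x‖ₑ ^ p := by
  have h0 : 0 < p := by linarith
  have hle : ∀ x, (2 * ‖psiDiff A u z x‖ₑ) ^ p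
      ≤ 2 ^ p * (2 ^ (p - 1) * (‖u (x + z)‖ₑ ^ p + ‖u x‖ₑ ^ p)) := fun x => by
    rw [ENNReal.mul_rpow_of_nonneg _ _ h0.le]
    gcongr
    refine le_trans ?_ (ENNReal.rpow_add_le_mul_rpow_add_rpow _ _ hp.le)
    gcongr
    rw [← ofReal_norm, ← ofReal_norm, ← ofReal_norm, ← ENNReal.ofReal_add (norm_nonneg _) (norm_nonneg _)]
    exact ENNReal.ofReal_le_ofReal (norm_psiDiff_le A u z x)
  refine (lintegral_mono hle).trans (le_of_eq ?_)
  rw [lintegral_const_mul _ (by fun_prop), lintegral_const_mul _ (by fun_prop),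
    lintegral_add_right _ (by fun_prop), lintegral_add_right_eq_self (fun x => ‖u x‖ₑ ^ p) z,
    ← two_mul, ← mul_assoc, ← mul_assoc, mul_assoc (2 ^ p : ENNReal)]
  congr 2
  conv_lhs => rw [← ENNReal.rpow_one 2]
  rw [← ENNReal.rpow_mul, one_mul, ← ENNReal.rpow_add _ _ (by simp) (by simp)]
  congr 1; ring

/-- The function equal to δ^p on the superlevel set and 0 elsewhere is at most δ^p, hence tends to 0
pointwise, and is dominated by (2|D_z|)^p. -/
theorem tendsto_rpow_mul_measure_superlevel (hA : Continuous A) (hu : Measurable u) (hp : 1 < p)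
    (hup : ∫⁻ x, ‖u x‖ₑ ^ p < ⊤) (z : RN N) :
    Tendsto (fun δ : ℝ => ENNReal.ofReal (δ ^ p) * volume {x | δ < absP p (psiDiff A u z x)})
      (𝓝[>] 0) (𝓝 0) := by
  have h0 : 0 < p := by linarith
  have hms := measurableSet_superlevel_fiber hA hu hp z
  have hfin : ∫⁻ x, (2 * ‖psiDiff A u z x‖ₑ) ^ p ≠ ⊤ :=
    ((lintegral_psiDiff_rpow_le A hu hp z).trans_lt (ENNReal.mul_lt_top (ENNReal.mul_lt_top
      (ENNReal.rpow_lt_top_of_nonneg h0.le (by simp)) (ENNReal.rpow_lt_top_of_nonneg h0.le (by simp)))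
      hup)).ne
  have hlim : Tendsto (fun δ : ℝ => ENNReal.ofReal (δ ^ p)) (𝓝[>] 0) (𝓝 0) := by
    have : Continuous fun δ : ℝ => ENNReal.ofReal (δ ^ p) :=
      ENNReal.continuous_ofReal.comp (Real.continuous_rpow_const h0.le)
    have h1 := this.tendsto 0
    rw [Real.zero_rpow h0.ne', ENNReal.ofReal_zero] at h1
    exact h1.mono_left nhdsWithin_le_nhds
  have h := tendsto_lintegral_filter_of_dominated_convergence (μ := (volume : Measure (RN N)))
    (l := 𝓝[>] (0 : ℝ))
    (F := fun δ => {x | δ < absP p (psiDiff A u z x)}.indicator fun _ => ENNReal.ofReal (δ ^ p))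
    (f := fun _ => 0) (fun x => (2 * ‖psiDiff A u z x‖ₑ) ^ p)
    (Eventually.of_forall fun δ => measurable_const.indicator (hms δ))
    (by
      filter_upwards [self_mem_nhdsWithin] with δ hδ
      have hδ : 0 < δ := hδ
      refine ae_of_all _ fun x => Set.indicator_apply_le' (fun hx => ?_) fun _ => zero_le
      have hx : δ < absP p (psiDiff A u z x) := hx
      have h1 := hx.le.trans (absP_le_two_mul_norm hp _)
      rw [← ENNReal.ofReal_rpow_of_pos hδ]
      refine ENNReal.rpow_le_rpow ((ENNReal.ofReal_le_ofReal h1).trans (le_of_eq ?_)) h0.le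
      rw [ENNReal.ofReal_mul (by norm_num), ENNReal.ofReal_ofNat, ofReal_norm])
    hfin
    (ae_of_all _ fun x => tendsto_of_tendsto_of_tendsto_of_le_of_le tendsto_const_nhds hlim
      (fun _ => zero_le) fun δ => Set.indicator_le_self _ _ x)
  simp only [lintegral_zero] at h
  refine h.congr fun δ => ?_
  rw [lintegral_indicator_const (hms δ)]

/-- Since the phase is unimodular, δ^p |{|D_z|_p > δ}| is bounded by a multiple of ∫ |u|^p uniformly
in z and δ; the kernel is integrable off the unit ball, so dominated convergence applies. -/
theorem IsNormUnitBall.tendsto_far_part (hK : IsNormUnitBall K) (hA : Continuous A)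
    (hu : Measurable u) (hp : 1 < p) (hup : ∫⁻ x, ‖u x‖ₑ ^ p < ⊤) :
    Tendsto (fun δ : ℝ => ∫⁻ z in {z : RN N | ‖z‖ ≤ 1}ᶜ, kernel p K z *
      (ENNReal.ofReal (δ ^ p) * volume {x | δ < absP p (psiDiff A u z x)})) (𝓝[>] 0) (𝓝 0) := by
  have h0 : 0 < p := by linarith
  have hk := hK.measurable_kernel (p := p)
  set C : ENNReal := 2 ^ p * 2 ^ p * ∫⁻ x, ‖u x‖ₑ ^ p with hC
  have hCt : C < ⊤ := ENNReal.mul_lt_top (ENNReal.mul_lt_top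
      (ENNReal.rpow_lt_top_of_nonneg h0.le (by simp)) (ENNReal.rpow_lt_top_of_nonneg h0.le (by simp)))
      hup
  have hs : MeasurableSet ({z : RN N | ‖z‖ ≤ 1}ᶜ) :=
    (measurableSet_le measurable_norm measurable_const).compl
  have hkfin : ∫⁻ z in {z : RN N | ‖z‖ ≤ 1}ᶜ, kernel p K z < ⊤ := by
    rw [← lintegral_indicator hs]
    refine (lintegral_mono fun w => ?_).trans_lt (hK.lintegral_kernel_mul_norm_lt_top hp)
    refine Set.indicator_apply_le' (fun hw => ?_) fun _ => zero_le
    have hw : 1 < ‖w‖ := not_le.1 hw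
    have h1 : (1 : ENNReal) < 4 * ‖w‖ₑ := by
      have h2 : 1 < 4 * ‖w‖ := by linarith
      rw [← ENNReal.ofReal_lt_ofReal_iff (by linarith), ENNReal.ofReal_mul (by norm_num),
        ENNReal.ofReal_ofNat, ofReal_norm, ENNReal.ofReal_one] at h2
      exact h2
    rw [Set.indicator_of_mem (by exact h1)]
    exact le_mul_of_one_le_right zero_le h1.le
  have h := tendsto_lintegral_filter_of_dominated_convergence
    (μ := (volume : Measure (RN N)).restrict {z : RN N | ‖z‖ ≤ 1}ᶜ) (l := 𝓝[>] (0 : ℝ))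
    (F := fun δ z => kernel p K z *
      (ENNReal.ofReal (δ ^ p) * volume {x | δ < absP p (psiDiff A u z x)}))
    (f := fun _ => 0) (fun z => kernel p K z * C)
    (Eventually.of_forall fun δ => hk.mul ((measurable_measure_superlevel hA hu hp δ).const_mul _))
    (by
      filter_upwards [self_mem_nhdsWithin] with δ hδ
      exact ae_of_all _ fun z => mul_le_mul_right ((rpow_mul_measure_superlevel_le hA hu hp z hδ).trans
        (lintegral_psiDiff_rpow_le A hu hp z)) _)
    (by
      rw [lintegral_mul_const _ hk]
      exact (ENNReal.mul_lt_top hkfin hCt).ne)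
    (ae_of_all _ fun z => by
      simpa using ENNReal.Tendsto.const_mul (a := kernel p K z)
        (tendsto_rpow_mul_measure_superlevel hA hu hp hup z) (Or.inr ENNReal.ofReal_ne_top))
  simpa using h

theorem near_part_eq {δ : ℝ} (hδ : 0 < δ) (m : RN N → ENNReal) :
    ∫⁻ z in {z : RN N | ‖z‖ ≤ 1}, kernel p K z * (ENNReal.ofReal (δ ^ p) * m z)
      = ∫⁻ w, {w : RN N | ‖δ • w‖ ≤ 1}.indicator (fun w => kernel p K w * m (δ • w)) w := by
  have hs : MeasurableSet {z : RN N | ‖z‖ ≤ 1} := measurableSet_le measurable_norm measurable_const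
  rw [← lintegral_indicator hs, lintegral_eq_mul_lintegral_comp_smul _ hδ,
    ← lintegral_const_mul' _ _ ENNReal.ofReal_ne_top]
  refine lintegral_congr fun w => ?_
  simp only [Set.indicator, Set.mem_ofPred_eq]
  split_ifs
  · rw [kernel_smul hδ]
    have : ENNReal.ofReal (δ ^ N) * ENNReal.ofReal ((δ ^ ((N : ℝ) + p))⁻¹) * ENNReal.ofReal (δ ^ p)
        = 1 := by
      rw [← ENNReal.ofReal_mul (by positivity), ← ENNReal.ofReal_mul (by positivity),
        Real.rpow_add hδ, Real.rpow_natCast, ← ENNReal.ofReal_one]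
      congr 1
      field_simp
    calc _ = (ENNReal.ofReal (δ ^ N) * ENNReal.ofReal ((δ ^ ((N : ℝ) + p))⁻¹) * ENNReal.ofReal (δ ^ p))
          * (kernel p K w * m (δ • w)) := by ring
      _ = _ := by rw [this, one_mul]
  · rw [mul_zero]

/-- The condition ‖δw‖ ≤ 1 absorbs the extra factor ‖z‖ of the Lipschitz term. The 4 is the product
of the 2 in |·|_p ≤ 2|·| and the threshold 2 of the segment estimate. -/
theorem IsWeakGradient.measure_superlevel_le (h : IsWeakGradient u G) (hu : StronglyMeasurable u)
    (hG : StronglyMeasurable G) {L : NNReal} (hA : LipschitzWith L A) (hp : 1 < p) {δ : ℝ}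
    (hδ : 0 < δ) {w : RN N} (hw : ‖δ • w‖ ≤ 1) :
    volume {x | δ < absP p (psiDiff A u (δ • w) x)}
      ≤ ∫⁻ x, {x | 1 < 4 * ‖w‖ₑ * (‖magGrad A u G x‖ₑ + L * ‖u x‖ₑ)}.indicator
        (fun x => 4 * ‖w‖ₑ * (‖magGrad A u G x‖ₑ + L * ‖u x‖ₑ)) x := by
  have hVm := (stronglyMeasurable_magGrad hA.continuous hu hG).measurable
  have hum := hu.measurable
  refine le_trans ?_ (measure_lt_mul_lintegral_segment_le
    (F := fun x => ‖magGrad A u G x‖ₑ + L * ‖u x‖ₑ) (by fun_prop) (δ • w) (4 * ‖w‖ₑ))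
  refine measure_mono_ae ?_
  filter_upwards [h.enorm_psiDiff_le hu hG hA (δ • w)] with x hx hxδ
  have hxδ : δ < absP p (psiDiff A u (δ • w) x) := hxδ
  have h1 := hxδ.trans_le (absP_le_two_mul_norm hp _)
  rw [← ENNReal.ofReal_lt_ofReal_iff (by linarith), ENNReal.ofReal_mul (by norm_num),
    ENNReal.ofReal_ofNat, ofReal_norm] at h1
  have hz1 : ‖δ • w‖ₑ ≤ 1 := by
    rw [← ofReal_norm, ← ENNReal.ofReal_one]; exact ENNReal.ofReal_le_ofReal hw
  have h2 : ‖psiDiff A u (δ • w) x‖ₑ ≤ ENNReal.ofReal δ * (‖w‖ₑ * ∫⁻ t in Set.Ioc (0 : ℝ) 1,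
      (‖magGrad A u G (x + t • δ • w)‖ₑ + L * ‖u (x + t • δ • w)‖ₑ)) := by
    refine hx.trans ?_
    have e : ‖δ • w‖ₑ = ENNReal.ofReal δ * ‖w‖ₑ := by
      rw [enorm_smul, ← ofReal_norm δ, Real.norm_of_nonneg hδ.le]
    rw [← mul_assoc, ← e]
    gcongr
    exact mul_le_of_le_one_right zero_le hz1
  set I := ∫⁻ t in Set.Ioc (0 : ℝ) 1,
      (‖magGrad A u G (x + t • δ • w)‖ₑ + L * ‖u (x + t • δ • w)‖ₑ) with hI
  have hδ0 : ENNReal.ofReal δ ≠ 0 := by simpa using hδ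
  change 2 < 4 * ‖w‖ₑ * I
  have h3 : ENNReal.ofReal δ * 1 < ENNReal.ofReal δ * (2 * (‖w‖ₑ * I)) := by
    rw [mul_one, mul_left_comm]
    exact h1.trans_le (mul_le_mul_right h2 2)
  have h4 : 1 < 2 * (‖w‖ₑ * I) := lt_of_mul_lt_mul_left' h3
  calc (2 : ENNReal) = 2 * 1 := (mul_one 2).symm
    _ < 2 * (2 * (‖w‖ₑ * I)) := ENNReal.mul_lt_mul_right (by simp) (by simp) h4
    _ = 4 * ‖w‖ₑ * I := by rw [← mul_assoc, ← mul_assoc]; norm_num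

theorem IsWeakGradient.tendsto_near_part (h : IsWeakGradient u G) (hK : IsNormUnitBall K)
    (hu : StronglyMeasurable u) (hG : StronglyMeasurable G) {L : NNReal} (hA : LipschitzWith L A)
    (hp : 1 < p) (hup : ∫⁻ x, ‖u x‖ₑ ^ p < ⊤) (hVp : ∫⁻ x, ‖magGrad A u G x‖ₑ ^ p < ⊤) :
    Tendsto (fun δ : ℝ => ∫⁻ w, {w : RN N | ‖δ • w‖ ≤ 1}.indicator (fun w => kernel p K w *
      volume {x | δ < absP p (psiDiff A u (δ • w) x)}) w) (𝓝[>] 0)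
      (𝓝 (∫⁻ w, kernel p K w * volume {x | 1 < absP p (cdot (magGrad A u G x) w)})) := by
  have h0 : 0 < p := by linarith
  have hVm := (stronglyMeasurable_magGrad hA.continuous hu hG).measurable
  have hum := hu.measurable
  have hk := hK.measurable_kernel (p := p)
  have hFp : ∫⁻ x, (‖magGrad A u G x‖ₑ + L * ‖u x‖ₑ) ^ p < ⊤ := by
    have h2 : (2 : ENNReal) ^ (p - 1) < ⊤ := ENNReal.rpow_lt_top_of_nonneg (by linarith) (by simp)
    have hL : (L : ENNReal) ^ p < ⊤ := ENNReal.rpow_lt_top_of_nonneg h0.le ENNReal.coe_ne_top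
    refine (lintegral_mono fun x => ENNReal.rpow_add_le_mul_rpow_add_rpow _ _ hp.le).trans_lt ?_
    rw [lintegral_const_mul _ (by fun_prop), lintegral_add_left (by fun_prop)]
    simp_rw [ENNReal.mul_rpow_of_nonneg _ _ h0.le]
    rw [lintegral_const_mul _ (by fun_prop)]
    exact ENNReal.mul_lt_top h2 (ENNReal.add_lt_top.2 ⟨hVp, ENNReal.mul_lt_top hL hup⟩)
  refine tendsto_lintegral_filter_of_dominated_convergence (fun w => kernel p K w *
      ∫⁻ x, {x | 1 < 4 * ‖w‖ₑ * (‖magGrad A u G x‖ₑ + L * ‖u x‖ₑ)}.indicator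
        (fun x => 4 * ‖w‖ₑ * (‖magGrad A u G x‖ₑ + L * ‖u x‖ₑ)) x)
    (Eventually.of_forall fun δ => ?_) ?_
    (hK.lintegral_kernel_truncated_lt_top hp (F := fun x => ‖magGrad A u G x‖ₑ + L * ‖u x‖ₑ)
      (by fun_prop) hFp).ne ?_
  · have h1 : Measurable fun w : RN N => volume {x | δ < absP p (psiDiff A u (δ • w) x)} :=
      (measurable_measure_superlevel hA.continuous hum hp δ).comp (f := fun w => δ • w) (by fun_prop)
    exact (hk.mul h1).indicator (measurableSet_le (by fun_prop) measurable_const)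
  · filter_upwards [self_mem_nhdsWithin] with δ hδ
    refine ae_of_all _ fun w => Set.indicator_apply_le' (fun hw => ?_) fun _ => zero_le
    exact mul_le_mul_right (h.measure_superlevel_le hu hG hA hp hδ hw) _
  · filter_upwards [ae_measure_level_eq_zero hp hVm] with w hw
    have h1 := ENNReal.Tendsto.const_mul (a := kernel p K w)
      (h.tendsto_measure_superlevel hu hG hA hp hup hVp w hw) (Or.inr ENNReal.ofReal_ne_top)
    refine h1.congr' ?_
    have h2 : Tendsto (fun δ : ℝ => ‖δ • w‖) (𝓝[>] 0) (𝓝 0) := by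
      have : Continuous fun δ : ℝ => ‖δ • w‖ := by fun_prop
      have h3 := this.tendsto 0
      rw [zero_smul, norm_zero] at h3
      exact h3.mono_left nhdsWithin_le_nhds
    -- For fixed w the cutoff ‖δw‖ ≤ 1 holds for all small δ.
    filter_upwards [h2.eventually_le_const zero_lt_one] with δ hδ
    rw [Set.indicator_of_mem (by exact hδ)]

theorem IsNormUnitBall.lintegral_kernel_mul_measure_eq (hN : 1 ≤ N) (hK : IsNormUnitBall K)
    (hp : 1 < p) (hV : Measurable (magGrad A u G)) :
    ∫⁻ w, kernel p K w * volume {x | 1 < absP p (cdot (magGrad A u G x) w)}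
      = magEnergy p K A u G := by
  have hk := hK.measurable_kernel (p := p)
  have hm : Measurable fun q : RN N × RN N => absP p (cdot (magGrad A u G q.2) q.1) :=
    (continuous_absP hp).measurable.comp ((measurable_cdot (N := N)).comp
      (f := fun q : RN N × RN N => (magGrad A u G q.2, q.1))
      ((hV.comp measurable_snd).prodMk measurable_fst))
  have hs : MeasurableSet {q : RN N × RN N | 1 < absP p (cdot (magGrad A u G q.2) q.1)} :=
    measurableSet_lt measurable_const hm
  calc ∫⁻ w, kernel p K w * volume {x | 1 < absP p (cdot (magGrad A u G x) w)}
      = ∫⁻ w, ∫⁻ x, {q : RN N × RN N | 1 < absP p (cdot (magGrad A u G q.2) q.1)}.indicator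
          (fun q => kernel p K q.1) (w, x) := by
        refine lintegral_congr fun w => ?_
        rw [← lintegral_indicator_const (measurableSet_lt measurable_const
          (measurable_absP_cdot hp hV w))]
        rfl
    _ = ∫⁻ x, ∫⁻ w, {q : RN N × RN N | 1 < absP p (cdot (magGrad A u G q.2) q.1)}.indicator
          (fun q => kernel p K q.1) (w, x) :=
        lintegral_lintegral_swap ((hk.comp measurable_fst).indicator hs).aemeasurable
    _ = magEnergy p K A u G :=
        lintegral_congr fun x => hK.lintegral_kernel_cdot hN hp (magGrad A u G x)

theorem IsNormUnitBall.lintegral_magGrad_lt_top (hK : IsNormUnitBall K)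
    (hp : 1 < p) (hE : magEnergy p K A u G < ⊤) : ∫⁻ x, ‖magGrad A u G x‖ₑ ^ p < ⊤ := by
  obtain ⟨c, hc, hcK⟩ := hK.exists_norm_le_momentNorm hp
  have h0 : 0 < p := by linarith
  calc ∫⁻ x, ‖magGrad A u G x‖ₑ ^ p
      ≤ ∫⁻ x, ENNReal.ofReal c * ENNReal.ofReal (momentNorm p K (magGrad A u G x) ^ p) := by
        refine lintegral_mono fun x => ?_
        rw [← ENNReal.ofReal_mul hc, ← ofReal_norm, ENNReal.ofReal_rpow_of_nonneg (norm_nonneg _) h0.le]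
        exact ENNReal.ofReal_le_ofReal (hcK _)
    _ = ENNReal.ofReal c * magEnergy p K A u G := lintegral_const_mul' _ _ ENNReal.ofReal_ne_top
    _ < ⊤ := ENNReal.mul_lt_top ENNReal.ofReal_lt_top hE

theorem IsWeakGradient.tendsto_nonlocalFunctional (h : IsWeakGradient u G) (hN : 1 ≤ N)
    (hK : IsNormUnitBall K) (hu : StronglyMeasurable u) (hG : StronglyMeasurable G) {L : NNReal}
    (hA : LipschitzWith L A) (hp : 1 < p) (hup : ∫⁻ x, ‖u x‖ₑ ^ p < ⊤)
    (hE : magEnergy p K A u G < ⊤) :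
    Tendsto (fun δ : ℝ => nonlocalFunctional p K A u δ) (𝓝[>] 0) (𝓝 (magEnergy p K A u G)) := by
  have hVp := hK.lintegral_magGrad_lt_top hp hE
  have h1 := (h.tendsto_near_part hK hu hG hA hp hup hVp).add
    (hK.tendsto_far_part hA.continuous hu.measurable hp hup)
  rw [add_zero, hK.lintegral_kernel_mul_measure_eq hN hp
    (stronglyMeasurable_magGrad hA.continuous hu hG).measurable] at h1
  refine h1.congr' ?_
  filter_upwards [self_mem_nhdsWithin] with δ hδ
  have hδ : 0 < δ := hδ
  rw [hK.nonlocalFunctional_eq hA.continuous hu.measurable hp δ,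
    ← near_part_eq hδ fun z => volume {x | δ < absP p (psiDiff A u z x)}]
  exact lintegral_add_compl _ (measurableSet_le measurable_norm measurable_const)

end Limit
end AnisoMagnetic

end

/-! ### Reduction to strongly measurable representatives. -/

theorem theorem1 (N : ℕ) (hN : 1 ≤ N) (p : ℝ) (hp : 1 < p)
    (K : Set (AnisoMagnetic.RN N)) (hK : AnisoMagnetic.IsNormUnitBall K)
    (A : AnisoMagnetic.RN N → AnisoMagnetic.RN N) (hA : ∃ L : NNReal, LipschitzWith L A)
    (u : AnisoMagnetic.RN N → ℂ) (hu : AnisoMagnetic.MemMagSobolev p K A u)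
    (gradu : AnisoMagnetic.RN N → AnisoMagnetic.CN N)
    (hgradu : AnisoMagnetic.IsWeakGradient u gradu) :
    Tendsto (fun δ : ℝ => AnisoMagnetic.nonlocalFunctional p K A u δ) (𝓝[>] 0)
      (𝓝 (AnisoMagnetic.magEnergy p K A u gradu)) := by
  have h0 : 0 < p := by linarith
  obtain ⟨L, hL⟩ := hA
  obtain ⟨G, hG, hGE⟩ := hu.exists_grad
  have hum := hu.memLp.1
  have hgm := hgradu.locallyIntegrable_grad.aestronglyMeasurable
  have hu_eq := hum.ae_eq_mk
  have hg_eq := hgm.ae_eq_mk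
  -- Finiteness is known for the gradient G; uniqueness of weak gradients transfers it to gradu.
  have hE : AnisoMagnetic.magEnergy p K A (hum.mk u) (hgm.mk gradu) < ⊤ := by
    rwa [← AnisoMagnetic.magEnergy_congr_ae hu_eq ((hG.ae_eq hgradu).trans hg_eq)]
  have hup : ∫⁻ x, ‖hum.mk u x‖ₑ ^ p < ⊤ := by
    have h1 := lintegral_rpow_enorm_lt_top_of_eLpNorm_lt_top (by simpa using h0)
      ENNReal.ofReal_ne_top ((memLp_congr_ae hu_eq).1 hu.memLp).2
    rwa [ENNReal.toReal_ofReal h0.le] at h1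
  simp_rw [AnisoMagnetic.nonlocalFunctional_congr_ae hu_eq]
  rw [AnisoMagnetic.magEnergy_congr_ae hu_eq hg_eq]
  exact (hgradu.congr_ae hu_eq hg_eq).tendsto_nonlocalFunctional hN hK hum.stronglyMeasurable_mk
    hgm.stronglyMeasurable_mk hL hp hup hE
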